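/- **Setting.** There are $N$ problems, each with $K$ candidate chains, and utilities $U(x,y)\in[0,1]$. A *judge* produces in each run a random table of scores $\tilde U(x,y)\in[0,1]$ for all pairs $(x,y)$ and is, for given $\delta\ge 0$ and $\eta\in(0,1/2]$, a noisy estimate of $U$ in the following sense: the errors $\tilde U(x,y)-U(x,y)$ have mean zero and are independent across chains, and with probability at least $1-\eta$ one has $|\tilde U(x,y)-U(x,y)|\le\delta$ for all $(x,y)$. Let $\pi_{\mathrm{ref}}(\cdot\mid x)$ be a reference policy on the $K$ chains of each problem and $\beta>0$. A reward function $r$ induces the policy $$\pi_r(y\mid x)=\frac{\pi_{\mathrm{ref}}(y\mid x)\,e^{r(x,y)/\beta}}{\sum_{z}\pi_{\mathrm{ref}}(z\mid x)\,e^{r(x,z)/\beta}},$$ and, for a probability distribution $D$ on the problems, $J_{D,U}(r)=\mathbb E_{x\sim D}\,\mathbb E_{y\sim\pi_r(\cdot\mid x)}\,U(x,y)$ is its expected utility. One *sample* is a triple $(x,y,s)$, where $x\sim D$, $y\sim\pi_{\mathrm{ref}}(\cdot\mid x)$ and $s=\tilde U(x,y)$ is the score of $(x,y)$ in a fresh independent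 run of the judge. The VC-dimension of a class of real-valued functions is the VC-dimension of the family of their subgraphs $\{((x,y),t): t<r(x,y)\}$ (the pseudo-dimension). **Theorem.** For all $\beta>0$ and $B$ there is a constant $C>0$, depending only on $\beta$ and $B$, such that for all $N,K,d\in\mathbb N$, $\varepsilon>0$, $\delta\ge0$ and $\eta\in(0,1/2]$ there is a number of samples $$m\;\le\; C\left(NK\log K+\frac{d}{\varepsilon^2}+\frac{N\delta^2}{\varepsilon^2}\right)\log\frac1\eta$$ with the following property. For every reference policy $\pi_{\mathrm{ref}}$ and every non-empty class $\mathcal H$ of reward functions with values in $[-B,B]$ and VC-dimension at most $d$, there is a measurable learning rule $A$ that maps $m$ samples to a reward function in $\mathcal H$, such that for every distribution $D$ on the problems, every utility function $U$ and every judge as above (all three unknown to the rule), with probability at least $1-\eta$ over $m$ independent samples $S$, $$J_{D,U}(A(S))\;\ge\;\sup_{r\in\mathcal H}J_{D,U}(r)-\varepsilon .$$ -/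

import Mathlib

open MeasureTheory ProbabilityTheory

noncomputable section

namespace UtilityLearning

/-- A table of real numbers indexed by problems `x : Fin N` and candidate chains `y : Fin K`:
a reward function, a utility function, or the scores of one run of the judge. -/
abbrev Table (N K : ℕ) : Type := Fin N → Fin K → ℝ

/-- The family `𝒜` of sets shatters the finite set `S`: it cuts out every subset of `S`. -/
def Shatters {α : Type*} (𝒜 : Set (Set α)) (S : Finset α) : Prop :=
  ∀ T : Finset α, T ⊆ S → ∃ A ∈ 𝒜, ∀ p ∈ S, p ∈ A ↔ p ∈ T

/-- The Vapnik-Chervonenkis dimension of a family of sets. -/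
def vcDim {α : Type*} (𝒜 : Set (Set α)) : ℕ∞ :=
  ⨆ (S : Finset α) (_ : Shatters 𝒜 S), (S.card : ℕ∞)

/-- The subgraph `{((x, y), t) | t < r(x, y)}` of a reward function. -/
def subgraph {N K : ℕ} (r : Table N K) : Set ((Fin N × Fin K) × ℝ) :=
  {p | p.2 < r p.1.1 p.1.2}

/-- The VC-dimension of a class of real-valued functions: that of the family of its subgraphs
(also known as the pseudo-dimension of the class). -/
def rewardVCDim {N K : ℕ} (H : Set (Table N K)) : ℕ∞ :=
  vcDim (subgraph '' H)

/-- The policy `π_r(y | x) ∝ π_ref(y | x) exp(r(x, y) / β)` induced by the reward `r`. -/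
def policy {N K : ℕ} (πref : Fin N → PMF (Fin K)) (β : ℝ) (r : Table N K)
    (x : Fin N) (y : Fin K) : ℝ :=
  (πref x y).toReal * Real.exp (r x y / β) /
    ∑ z : Fin K, (πref x z).toReal * Real.exp (r x z / β)

/-- The expected utility `E_{x ∼ D} E_{y ∼ π_r(· | x)} U(x, y)` of the policy induced by `r`. -/
def expectedUtility {N K : ℕ} (D : PMF (Fin N)) (πref : Fin N → PMF (Fin K)) (β : ℝ)
    (U : Table N K) (r : Table N K) : ℝ :=
  ∑ x : Fin N, (D x).toReal * ∑ y : Fin K, policy πref β r x y * U x y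

/-- `Q`, the law of the table of scores produced by one run of the judge, is a noisy unbiased
estimate of the utilities `U`: scores lie in `[0, 1]`, the errors have mean zero and are
independent across chains, and with probability at least `1 - η` all of them are at most `δ` in
absolute value. -/
structure IsNoisyJudge {N K : ℕ} (U : Table N K) (δ η : ℝ) (Q : Measure (Table N K)) : Prop where
  isProbabilityMeasure : IsProbabilityMeasure Q
  score_mem : ∀ᵐ s ∂Q, ∀ x y, s x y ∈ Set.Icc (0 : ℝ) 1
  unbiased : ∀ x y, ∫ s, (s x y - U x y) ∂Q = 0
  indep : iIndepFun (fun (c : Fin N × Fin K) (s : Table N K) => s c.1 c.2 - U c.1 c.2) Q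
  accurate : ENNReal.ofReal (1 - η) ≤ Q {s | ∀ x y, |s x y - U x y| ≤ δ}

/-- A labelled example: a problem, one of its chains, and a score of that chain. -/
abbrev Example (N K : ℕ) : Type := Fin N × Fin K × ℝ

/-- The law of one labelled example: a problem `x ∼ D`, a chain `y ∼ π_ref(· | x)`, and the score
that an independent run of the judge gives to `(x, y)`. -/
def exampleLaw {N K : ℕ} (D : PMF (Fin N)) (πref : Fin N → PMF (Fin K))
    (Q : Measure (Table N K)) : Measure (Example N K) :=
  (((D.bind fun x => (πref x).map (Prod.mk x)).toMeasure).prod Q).map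
    fun p => (p.1.1, p.1.2, p.2 p.1.1 p.1.2)

/-- The law of `m` independent labelled examples. -/
def sampleLaw {N K : ℕ} (m : ℕ) (D : PMF (Fin N)) (πref : Fin N → PMF (Fin K))
    (Q : Measure (Table N K)) : Measure (Fin m → Example N K) :=
  Measure.pi fun _ => exampleLaw D πref Q

/-- The learner `A`, which maps `m` labelled examples to a reward function in `H`, is successful at
accuracy `ε` and confidence `1 - η`: whatever the distribution of problems, the utilities and a
judge with parameters `δ`, `η`, its output has, with probability at least `1 - η`, an expected
utility within `ε` of the best that is attainable in `H`. -/
structure IsSuccessfulLearner {N K : ℕ} (πref : Fin N → PMF (Fin K)) (β : ℝ)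
    (H : Set (Table N K)) (ε δ η : ℝ) (m : ℕ) (A : (Fin m → Example N K) → Table N K) : Prop where
  measurable : Measurable A
  output_mem : ∀ S, A S ∈ H
  success : ∀ (D : PMF (Fin N)) (U : Table N K) (Q : Measure (Table N K)),
    (∀ x y, U x y ∈ Set.Icc (0 : ℝ) 1) → IsNoisyJudge U δ η Q →
    ENNReal.ofReal (1 - η) ≤ sampleLaw m D πref Q
      {S | ∀ r ∈ H, expectedUtility D πref β U r - ε ≤ expectedUtility D πref β U (A S)}

end UtilityLearning

end

namespace UtilityLearning

/-- **Sauer-Shelah lemma** for an indexed family of sets told apart by the points of `S`. -/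
theorem card_le_sum_choose_of_separated {α ι : Type*} (T : Finset ι) (f : ι → Set α)
    (S : Finset α) (d : ℕ) (hd : ∀ s : Finset α, Shatters (f '' T) s → s.card ≤ d)
    (hS : ∀ i ∈ T, ∀ j ∈ T, (∀ p ∈ S, p ∈ f i ↔ p ∈ f j) → i = j) :
    T.card ≤ ∑ k ∈ Finset.range (d + 1), S.card.choose k := by
  classical
  set tr : ι → Finset α := fun i => S.filter (· ∈ f i) with htr
  have hmem : ∀ i p, p ∈ tr i ↔ p ∈ S ∧ p ∈ f i := fun i p => by simp [htr]
  have hinj : Set.InjOn tr T := by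
    intro i hi j hj hij
    refine hS i hi j hj fun p hp => ?_
    have := Finset.ext_iff.1 hij p
    rw [hmem, hmem] at this
    tauto
  rw [← Finset.card_image_of_injOn hinj]
  refine (Finset.card_le_card_shatterer _).trans ?_
  have hsub : (T.image tr).shatterer ⊆
      (Finset.range (d + 1)).biUnion fun k => Finset.powersetCard k S := by
    intro s hs
    rw [Finset.mem_shatterer] at hs
    simp only [Finset.mem_biUnion, Finset.mem_range, Finset.mem_powersetCard]
    refine ⟨s.card, Nat.lt_succ_of_le (hd s ?_), ?_, rfl⟩
    · intro t ht
      obtain ⟨u, hu, hut⟩ := hs ht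
      obtain ⟨i, hi, rfl⟩ := Finset.mem_image.1 hu
      refine ⟨f i, ⟨i, hi, rfl⟩, fun p hp => ?_⟩
      obtain ⟨w, hw, hws⟩ := hs (Finset.Subset.refl s)
      obtain ⟨j, -, rfl⟩ := Finset.mem_image.1 hw
      have hpS : p ∈ S := by
        have : p ∈ s ∩ tr j := by rw [hws]; exact hp
        exact ((hmem _ _).1 (Finset.mem_inter.1 this).2).1
      rw [← hut, Finset.mem_inter, hmem]
      tauto
    · intro p hp
      obtain ⟨w, hw, hws⟩ := hs (Finset.Subset.refl s)
      obtain ⟨j, -, rfl⟩ := Finset.mem_image.1 hw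
      have : p ∈ s ∩ tr j := by rw [hws]; exact hp
      exact ((hmem _ _).1 (Finset.mem_inter.1 this).2).1
  refine (Finset.card_le_card hsub).trans (Finset.card_biUnion_le.trans ?_)
  simp [Finset.card_powersetCard]

theorem sum_choose_mul_pow_le (n d : ℕ) {x : ℝ} (hx : 0 ≤ x) (hx1 : x ≤ 1) :
    ((∑ k ∈ Finset.range (d + 1), n.choose k : ℕ) : ℝ) * x ^ d ≤ Real.exp (n * x) := by
  have h1 : ((∑ k ∈ Finset.range (d + 1), n.choose k : ℕ) : ℝ) * x ^ d
      ≤ ∑ k ∈ Finset.range (d + 1), (n.choose k : ℝ) * x ^ k := by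
    push_cast
    rw [Finset.sum_mul]
    refine Finset.sum_le_sum fun k hk => ?_
    exact mul_le_mul_of_nonneg_left
      (pow_le_pow_of_le_one hx hx1 (Nat.lt_succ_iff.1 (Finset.mem_range.1 hk))) (by positivity)
  have h2 : ∑ k ∈ Finset.range (d + 1), (n.choose k : ℝ) * x ^ k
      ≤ ∑ k ∈ Finset.range (max d n + 1), (n.choose k : ℝ) * x ^ k :=
    Finset.sum_le_sum_of_subset_of_nonneg
      (Finset.range_mono (by omega)) fun k _ _ => by positivity
  have h3 : ∑ k ∈ Finset.range (max d n + 1), (n.choose k : ℝ) * x ^ k = (x + 1) ^ n := by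
    rw [add_pow]
    symm
    refine Finset.sum_subset_zero_on_sdiff (Finset.range_mono (by omega)) ?_ ?_
    · intro k hk
      rw [Finset.mem_sdiff, Finset.mem_range, Finset.mem_range] at hk
      rw [Nat.choose_eq_zero_of_lt (by omega)]
      simp
    · intro k _
      simp [mul_comm]
  calc _ ≤ (x + 1) ^ n := h1.trans (h2.trans h3.le)
    _ ≤ (Real.exp x) ^ n := pow_le_pow_left₀ (by linarith) (Real.add_one_le_exp x) n
    _ = _ := by rw [← Real.exp_nat_mul]

/-- Greedy choice of points that tell apart pairs. -/
theorem exists_finset_separating {α κ : Type*} (P : Finset κ) (D : κ → α → Prop) (τ : ℝ)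
    (hτ1 : τ ≤ 1)
    (h : ∀ P' ⊆ P, ∃ p, ∃ Q ⊆ P', (∀ k ∈ Q, D k p) ∧ τ * P'.card ≤ Q.card) (n : ℕ) :
    ∃ S : Finset α, S.card ≤ n ∧ ∃ P' ⊆ P, (∀ k ∈ P, k ∉ P' → ∃ p ∈ S, D k p) ∧
      (P'.card : ℝ) ≤ (1 - τ) ^ n * P.card := by
  classical
  induction n with
  | zero => exact ⟨∅, by simp, P, subset_rfl, fun k hk hk' => absurd hk hk', by simp⟩
  | succ n ih =>
    obtain ⟨S, hS, P', hP', hD, hc⟩ := ih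
    obtain ⟨p, Q, hQ, hQD, hQc⟩ := h P' hP'
    refine ⟨insert p S, (Finset.card_insert_le _ _).trans (by omega), P' \ Q,
      Finset.sdiff_subset.trans hP', fun k hk hk' => ?_, ?_⟩
    · by_cases hkP : k ∈ P'
      · have : k ∈ Q := by
          by_contra hq
          exact hk' (Finset.mem_sdiff.2 ⟨hkP, hq⟩)
        exact ⟨p, Finset.mem_insert_self _ _, hQD k this⟩
      · obtain ⟨q, hq, hqD⟩ := hD k hk hkP
        exact ⟨q, Finset.mem_insert_of_mem hq, hqD⟩
    · have : ((P' \ Q).card : ℝ) = P'.card - Q.card := by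
        rw [Finset.card_sdiff_of_subset hQ, Nat.cast_sub (Finset.card_le_card hQ)]
      rw [this, pow_succ]
      nlinarith

theorem setIntegral_indicator_Ico_min_max {B u v : ℝ} (hu : |u| ≤ B) (hv : |v| ≤ B) :
    ∫ t in Set.Icc (-B) B, (Set.Ico (min u v) (max u v)).indicator (fun _ => (1 : ℝ)) t
      = |u - v| := by
  rw [setIntegral_indicator measurableSet_Ico]
  have : Set.Icc (-B) B ∩ Set.Ico (min u v) (max u v) = Set.Ico (min u v) (max u v) := by
    refine Set.inter_eq_right.2 fun t ht => ?_
    rw [abs_le] at hu hv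
    exact ⟨le_trans (le_min hu.1 hv.1) ht.1, ht.2.le.trans (max_le hu.2 hv.2)⟩
  rw [this]
  simp only [setIntegral_const, smul_eq_mul, mul_one, Measure.real, Real.volume_Ico]
  rw [max_sub_min_eq_abs', ENNReal.toReal_ofReal (abs_nonneg _)]

/-- Some threshold tells apart an average share of a family of pairs of functions. -/
theorem exists_threshold {β κ : Type*} [Fintype β] (P : Finset κ) (μ : β → ℝ)
    (hμ : ∀ b, 0 ≤ μ b) (hμ1 : ∑ b, μ b = 1) (u v : κ → β → ℝ) {B τ : ℝ}
    (hu : ∀ k ∈ P, ∀ b, |u k b| ≤ B) (hv : ∀ k ∈ P, ∀ b, |v k b| ≤ B)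
    (hsep : ∀ k ∈ P, 2 * B * τ < ∑ b, μ b * |u k b - v k b|) :
    ∃ p : β × ℝ, ∃ Q ⊆ P, (∀ k ∈ Q, ¬(p.2 < u k p.1 ↔ p.2 < v k p.1)) ∧
      τ * P.card ≤ Q.card := by
  classical
  have hne : Nonempty β := by
    by_contra hb
    rw [not_nonempty_iff] at hb
    simp at hμ1
  rcases P.eq_empty_or_nonempty with rfl | hP
  · exact ⟨(hne.some, 0), ∅, by simp, by simp, by simp⟩
  have hB : 0 ≤ B := by
    obtain ⟨k, hk⟩ := hP
    exact (abs_nonneg _).trans (hu k hk hne.some)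
  by_contra! hcon
  have key : ∀ b, ∑ k ∈ P, |u k b - v k b| ≤ 2 * B * (τ * P.card) := by
    intro b
    have hfin : ∀ k ∈ P, IntegrableOn
        ((Set.Ico (min (u k b) (v k b)) (max (u k b) (v k b))).indicator
          (fun _ => (1 : ℝ))) (Set.Icc (-B) B) volume := fun k _ =>
      (integrableOn_const (by simp)).indicator measurableSet_Ico
    calc ∑ k ∈ P, |u k b - v k b|
        = ∫ t in Set.Icc (-B) B, ∑ k ∈ P,
          (Set.Ico (min (u k b) (v k b)) (max (u k b) (v k b))).indicator
            (fun _ => (1 : ℝ)) t := by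
          rw [integral_finsetSum _ hfin]
          exact Finset.sum_congr rfl fun k hk =>
            (setIntegral_indicator_Ico_min_max (hu k hk b) (hv k hk b)).symm
      _ ≤ ∫ t in Set.Icc (-B) B, τ * P.card := by
          refine integral_mono (integrable_finsetSum _ hfin) (integrable_const _) fun t => ?_
          have h1 := hcon (b, t) (P.filter fun k =>
            t ∈ Set.Ico (min (u k b) (v k b)) (max (u k b) (v k b)))
            (Finset.filter_subset _ _) (fun k hk => ?_)
          · refine le_trans (le_of_eq ?_) h1.le
            simp only [Set.indicator_apply]
            rw [Finset.sum_boole]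
          · have := (Finset.mem_filter.1 hk).2
            simp only [Set.mem_Ico, min_le_iff, lt_max_iff] at this
            rcases this with ⟨h1 | h1, h2 | h2⟩ <;> simp only <;> grind
      _ = 2 * B * (τ * P.card) := by
          simp only [setIntegral_const, smul_eq_mul, Measure.real, Real.volume_Icc]
          rw [ENNReal.toReal_ofReal (by linarith)]
          ring
  have h1 : ∑ k ∈ P, 2 * B * τ < ∑ k ∈ P, ∑ b, μ b * |u k b - v k b| :=
    Finset.sum_lt_sum_of_nonempty hP hsep
  rw [Finset.sum_comm] at h1
  have h2 : ∑ b, ∑ k ∈ P, μ b * |u k b - v k b| ≤ ∑ b, μ b * (2 * B * (τ * P.card)) := by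
    refine Finset.sum_le_sum fun b _ => ?_
    rw [← Finset.mul_sum]
    exact mul_le_mul_of_nonneg_left (key b) (hμ b)
  rw [← Finset.sum_mul, hμ1] at h2
  simp only [Finset.sum_const, nsmul_eq_mul] at h1
  linarith

/-- The `L¹` distance of two tables with respect to weights on the cells. -/
noncomputable def weightedDist {N K : ℕ} (μ : Fin N × Fin K → ℝ) (r s : Table N K) : ℝ :=
  ∑ c, μ c * |r c.1 c.2 - s c.1 c.2|

theorem Shatters.mono {α : Type*} {𝒜 ℬ : Set (Set α)} (h : 𝒜 ⊆ ℬ) {S : Finset α}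
    (hS : Shatters 𝒜 S) : Shatters ℬ S := fun T hT =>
  let ⟨A, hA, hp⟩ := hS T hT
  ⟨A, h hA, hp⟩

theorem card_le_of_rewardVCDim_le {N K d : ℕ} {H : Set (Table N K)} (h : rewardVCDim H ≤ d)
    {S : Finset ((Fin N × Fin K) × ℝ)} (hS : Shatters (subgraph '' H) S) : S.card ≤ d := by
  have : (S.card : ℕ∞) ≤ rewardVCDim H := le_iSup₂_of_le (f := fun S _ => (S.card : ℕ∞)) S hS le_rfl
  exact_mod_cast this.trans h

/-- A packing bound for classes of bounded pseudo-dimension. -/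
theorem card_le_of_separated {N K d : ℕ} {H : Set (Table N K)} (hH : rewardVCDim H ≤ d)
    (hd : 1 ≤ d) {B : ℝ} (hB : ∀ r ∈ H, ∀ x y, |r x y| ≤ B) (μ : Fin N × Fin K → ℝ)
    (hμ : ∀ c, 0 ≤ μ c) (hμ1 : ∑ c, μ c = 1) {τ : ℝ} (hτ : 0 < τ) (hτ1 : τ ≤ 1)
    (T : Finset (Table N K)) (hT : ∀ r ∈ T, r ∈ H)
    (hsep : ∀ r ∈ T, ∀ s ∈ T, r ≠ s → 2 * B * τ < weightedDist μ r s) :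
    Real.log T.card ≤ 2 * (d * Real.log (8 / τ)) := by
  classical
  have hlog8 : 2 ≤ Real.log (8 / τ) := by
    have h1 : Real.log 8 ≤ Real.log (8 / τ) :=
      Real.log_le_log (by norm_num) (by rw [le_div_iff₀ hτ]; linarith)
    have h2 : Real.log 8 = 3 * Real.log 2 := by
      rw [show (8 : ℝ) = 2 ^ 3 by norm_num, Real.log_pow]; norm_num
    have := Real.log_two_gt_d9
    linarith
  have hd' : (1 : ℝ) ≤ d := by exact_mod_cast hd
  have hdl : 2 ≤ d * Real.log (8 / τ) := by nlinarith
  rcases T.eq_empty_or_nonempty with rfl | hTne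
  · simp; linarith
  set M : ℝ := (T.card : ℝ) with hM
  have hM1 : 1 ≤ M := by
    rw [hM]; exact_mod_cast hTne.card_pos
  have hM0 : 0 < M := by linarith
  have hlM : 0 ≤ Real.log M := Real.log_nonneg hM1
  set n : ℕ := ⌊2 * Real.log M / τ⌋₊ + 1 with hn
  have hn1 : 2 * Real.log M / τ < n := by
    rw [hn]; push_cast; exact Nat.lt_floor_add_one _
  have hn2 : (n : ℝ) ≤ 2 * Real.log M / τ + 1 := by
    rw [hn]; push_cast
    have := Nat.floor_le (a := 2 * Real.log M / τ) (by positivity)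
    linarith
  obtain ⟨S, hS, P', hP', hsepP, hcard⟩ := exists_finset_separating
    (α := (Fin N × Fin K) × ℝ) T.offDiag
    (fun k p => ¬(p.2 < k.1 p.1.1 p.1.2 ↔ p.2 < k.2 p.1.1 p.1.2)) τ hτ1
    (fun P' hP' => exists_threshold P' μ hμ hμ1
      (fun k c => k.1 c.1 c.2) (fun k c => k.2 c.1 c.2) (B := B)
      (fun k hk c => hB _ (hT _ (Finset.mem_offDiag.1 (hP' hk)).1) _ _)
      (fun k hk c => hB _ (hT _ (Finset.mem_offDiag.1 (hP' hk)).2.1) _ _)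
      (fun k hk => hsep _ (Finset.mem_offDiag.1 (hP' hk)).1 _ (Finset.mem_offDiag.1 (hP' hk)).2.1
        (Finset.mem_offDiag.1 (hP' hk)).2.2)) n
  have hoff : (T.offDiag.card : ℝ) ≤ M ^ 2 := by
    have : T.offDiag.card ≤ T.card * T.card := by
      rw [Finset.offDiag_card]; omega
    rw [hM, sq]; exact_mod_cast this
  have hlt : (P'.card : ℝ) < 1 := by
    have h1 : (1 - τ) ^ n ≤ Real.exp (-(n * τ)) := by
      calc (1 - τ) ^ n ≤ Real.exp (-τ) ^ n :=
            pow_le_pow_left₀ (by linarith) (by linarith [Real.add_one_le_exp (-τ)]) n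
        _ = _ := by rw [← Real.exp_nat_mul]; congr 1; ring
    have h2 : M ^ 2 = Real.exp (2 * Real.log M) := by
      rw [two_mul, Real.exp_add, Real.exp_log hM0, sq]
    calc (P'.card : ℝ) ≤ (1 - τ) ^ n * T.offDiag.card := hcard
      _ ≤ Real.exp (-(n * τ)) * M ^ 2 := by gcongr
      _ = Real.exp (2 * Real.log M - n * τ) := by
          rw [h2, ← Real.exp_add]; congr 1; ring
      _ < 1 := by
          rw [Real.exp_lt_one_iff]
          rw [div_lt_iff₀ hτ] at hn1
          linarith
  have hP'0 : P' = ∅ := by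
    rw [← Finset.card_eq_zero]
    have : P'.card < 1 := by exact_mod_cast hlt
    omega
  have hsauer := card_le_sum_choose_of_separated T subgraph S d
    (fun s hs => card_le_of_rewardVCDim_le hH (hs.mono (Set.image_mono hT)))
    (fun r hr s hs h => by
      by_contra hne
      obtain ⟨p, hp, hpD⟩ := hsepP (r, s) (Finset.mem_offDiag.2 ⟨hr, hs, hne⟩) (by simp [hP'0])
      exact hpD (h p hp))
  have hx := sum_choose_mul_pow_le S.card d (x := τ / 8) (by positivity) (by linarith)
  have h3 : M * (τ / 8) ^ d ≤ Real.exp (n * (τ / 8)) := by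
    calc M * (τ / 8) ^ d
        ≤ ((∑ k ∈ Finset.range (d + 1), S.card.choose k : ℕ) : ℝ) * (τ / 8) ^ d := by
          gcongr; rw [hM]; exact_mod_cast hsauer
      _ ≤ _ := hx
      _ ≤ _ := by
          refine Real.exp_le_exp.2 (mul_le_mul_of_nonneg_right ?_ (by positivity))
          exact_mod_cast hS
  have h4 := Real.log_le_log (by positivity) h3
  rw [Real.log_exp, Real.log_mul (by positivity) (by positivity), Real.log_pow] at h4
  have h5 : Real.log (τ / 8) = -Real.log (8 / τ) := by
    rw [← Real.log_inv, inv_div]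
  have h6 : (n : ℝ) * (τ / 8) ≤ Real.log M / 4 + 1 / 8 := by
    calc (n : ℝ) * (τ / 8) ≤ (2 * Real.log M / τ + 1) * (τ / 8) := by gcongr
      _ = Real.log M / 4 + τ / 8 := by field_simp; ring
      _ ≤ _ := by linarith
  rw [h5] at h4
  linarith

/-- Nets with a number of points that is exponential in the pseudo-dimension. -/
theorem exists_net {N K d : ℕ} {H : Set (Table N K)} (hH : rewardVCDim H ≤ d)
    (hd : 1 ≤ d) {B : ℝ} (hB : ∀ r ∈ H, ∀ x y, |r x y| ≤ B) (μ : Fin N × Fin K → ℝ)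
    (hμ : ∀ c, 0 ≤ μ c) (hμ1 : ∑ c, μ c = 1) (F : Finset (Table N K)) (hF : ∀ r ∈ F, r ∈ H)
    (k : ℕ) :
    ∃ T ⊆ F, (T.card : ℝ) ≤ Real.exp (5 * d * (k + 1)) ∧
      ∀ r ∈ F, ∃ s ∈ T, weightedDist μ r s ≤ 2 * B * (1 / 4) ^ k := by
  classical
  set τ : ℝ := (1 / 4) ^ k with hτ
  have hτ0 : 0 < τ := by positivity
  have hτ1 : τ ≤ 1 := pow_le_one₀ (by norm_num) (by norm_num)
  have hB0 : ∀ r ∈ F, weightedDist μ r r ≤ 2 * B * τ ∨ F = ∅ := by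
    intro r hr
    left
    have : weightedDist μ r r = 0 := by simp [weightedDist]
    rw [this]
    have hne : Nonempty (Fin N × Fin K) := by
      by_contra hb
      rw [not_nonempty_iff] at hb
      simp at hμ1
    have : 0 ≤ B := (abs_nonneg _).trans (hB r (hF r hr) hne.some.1 hne.some.2)
    positivity
  obtain ⟨p, hp⟩ : ∃ p : Finset (Table N K) → Prop, ∀ T, p T ↔
      ∀ r ∈ T, ∀ s ∈ T, r ≠ s → 2 * B * τ < weightedDist μ r s := ⟨_, fun _ => Iff.rfl⟩
  obtain ⟨T, hTmem, hTmax⟩ := Finset.exists_max_image (F.powerset.filter p)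
    Finset.card ⟨∅, by simp [hp]⟩
  rw [Finset.mem_filter, Finset.mem_powerset, hp] at hTmem
  refine ⟨T, hTmem.1, ?_, fun r hr => ?_⟩
  · have h := card_le_of_separated hH hd hB μ hμ hμ1 hτ0 hτ1 T
      (fun r hr => hF r (hTmem.1 hr)) hTmem.2
    have hl : Real.log (8 / τ) = (2 * k + 3) * Real.log 2 := by
      rw [Real.log_div (by norm_num) hτ0.ne', hτ, Real.log_pow,
        show (8 : ℝ) = 2 ^ 3 by norm_num, Real.log_pow, one_div, Real.log_inv,
        show (4 : ℝ) = 2 ^ 2 by norm_num, Real.log_pow]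
      push_cast; ring
    have h2 : Real.log T.card ≤ 5 * d * (k + 1) := by
      refine h.trans ?_
      rw [hl]
      have := Real.log_two_lt_d9
      have hk : (0 : ℝ) ≤ k := Nat.cast_nonneg k
      have h0 : (0 : ℝ) ≤ d := Nat.cast_nonneg d
      have : (2 * (k : ℝ) + 3) * Real.log 2 ≤ (2 * k + 3) * 0.7 := by gcongr; linarith
      nlinarith [mul_le_mul_of_nonneg_left this h0, mul_nonneg h0 hk]
    rcases T.eq_empty_or_nonempty with rfl | hTne
    · simp; positivity
    · exact (Real.log_le_iff_le_exp (by exact_mod_cast hTne.card_pos)).1 h2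
  · by_contra! hcon
    have hrT : r ∉ T := fun h => by
      rcases hB0 r hr with h1 | h1
      · exact absurd h1 (not_le.2 (hcon r h))
      · simp [h1] at hr
    have hsymm : ∀ a b : Table N K, weightedDist μ a b = weightedDist μ b a := fun a b => by
      simp only [weightedDist, abs_sub_comm]
    have := hTmax (insert r T) (by
      rw [Finset.mem_filter, Finset.mem_powerset, hp]
      refine ⟨Finset.insert_subset hr hTmem.1, fun a ha b hb hab => ?_⟩
      rw [Finset.mem_insert] at ha hb
      rcases ha with rfl | ha <;> rcases hb with rfl | hb
      · exact absurd rfl hab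
      · exact hcon b hb
      · rw [hsymm]; exact hcon a ha
      · exact hTmem.2 a ha b hb hab)
    rw [Finset.card_insert_of_notMem hrT] at this
    omega

/-- The sign `±1` encoded by a Boolean. -/
def boolSign (b : Bool) : ℝ := if b then 1 else -1

theorem abs_boolSign (b : Bool) : |boolSign b| = 1 := by cases b <;> simp [boolSign]

/-- The signed sum of a vector. -/
def signedSum {ι : Type*} [Fintype ι] (σ : ι → Bool) (v : ι → ℝ) : ℝ := ∑ i, boolSign (σ i) * v i

theorem sum_exp_signedSum_le {ι : Type*} [Fintype ι] [DecidableEq ι] (v : ι → ℝ) (c : ℝ) :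
    ∑ σ : ι → Bool, Real.exp (c * signedSum σ v)
      ≤ 2 ^ Fintype.card ι * Real.exp (c ^ 2 * (∑ i, v i ^ 2) / 2) := by
  classical
  have h : ∑ σ : ι → Bool, Real.exp (c * signedSum σ v)
      = ∏ i, ∑ b : Bool, Real.exp (c * (boolSign b * v i)) := by
    rw [Finset.prod_univ_sum, Fintype.piFinset_univ]
    refine Finset.sum_congr rfl fun σ _ => ?_
    rw [signedSum, Finset.mul_sum, Real.exp_sum]
  rw [h]
  calc ∏ i, ∑ b : Bool, Real.exp (c * (boolSign b * v i))
      ≤ ∏ i, 2 * Real.exp ((c * v i) ^ 2 / 2) := by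
        refine Finset.prod_le_prod (fun i _ => by positivity) fun i _ => ?_
        have := Real.cosh_le_exp_half_sq (c * v i)
        rw [Real.cosh_eq] at this
        simp only [Fintype.sum_bool, boolSign]
        simp only [if_true, one_mul, Bool.false_eq_true, if_false, neg_mul, mul_neg]
        linarith
    _ = _ := by
        rw [Finset.prod_mul_distrib, ← Real.exp_sum]
        simp only [Finset.prod_const, Finset.card_univ]
        congr 2
        rw [Finset.mul_sum, Finset.sum_div]
        exact Finset.sum_congr rfl fun i _ => by ring

theorem sum_exp_abs_signedSum_le {ι : Type*} [Fintype ι] [DecidableEq ι] (v : ι → ℝ) (c : ℝ) :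
    ∑ σ : ι → Bool, Real.exp (c * |signedSum σ v|)
      ≤ 2 ^ Fintype.card ι * (2 * Real.exp (c ^ 2 * (∑ i, v i ^ 2) / 2)) := by
  have h1 := sum_exp_signedSum_le v c
  have h2 := sum_exp_signedSum_le v (-c)
  rw [neg_sq] at h2
  calc ∑ σ : ι → Bool, Real.exp (c * |signedSum σ v|)
      ≤ ∑ σ : ι → Bool, (Real.exp (c * signedSum σ v) + Real.exp (-c * signedSum σ v)) := by
        refine Finset.sum_le_sum fun σ _ => ?_
        rcases abs_choice (signedSum σ v) with h | h <;> rw [h]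
        · linarith [Real.exp_pos (-c * signedSum σ v)]
        · rw [mul_neg, ← neg_mul]; linarith [Real.exp_pos (c * signedSum σ v)]
    _ ≤ _ := by rw [Finset.sum_add_distrib]; linarith

theorem sum_half_pow (n : ℕ) :
    ∑ k ∈ Finset.range n, (1 / 2 : ℝ) ^ (k + 1) = 1 - (1 / 2) ^ n := by
  induction n with
  | zero => simp
  | succ n ih => rw [Finset.sum_range_succ, ih]; ring

theorem sum_half_pow_mul (n : ℕ) :
    ∑ k ∈ Finset.range n, (1 / 2 : ℝ) ^ (k + 1) * (2 * k + 1) = 3 - (2 * n + 3) * (1 / 2) ^ n := by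
  induction n with
  | zero => norm_num
  | succ n ih => rw [Finset.sum_range_succ, ih]; push_cast; ring

/-- Convexity of the exponential with dyadic weights. -/
theorem exp_sum_half_pow_le (n : ℕ) (u : ℕ → ℝ) :
    Real.exp (∑ k ∈ Finset.range n, (1 / 2 : ℝ) ^ (k + 1) * u k)
      ≤ ∑ k ∈ Finset.range n, (1 / 2 : ℝ) ^ (k + 1) * Real.exp (u k) + (1 / 2) ^ n := by
  induction n generalizing u with
  | zero => simp
  | succ n ih =>
    have h := ih fun k => u (k + 1)
    rw [Finset.sum_range_succ', Finset.sum_range_succ']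
    set A := ∑ k ∈ Finset.range n, (1 / 2 : ℝ) ^ (k + 1) * u (k + 1)
    have hA : ∑ k ∈ Finset.range n, (1 / 2 : ℝ) ^ (k + 1 + 1) * u (k + 1) = A / 2 := by
      rw [Finset.sum_div]
      exact Finset.sum_congr rfl fun k _ => by ring
    have hE : ∑ k ∈ Finset.range n, (1 / 2 : ℝ) ^ (k + 1 + 1) * Real.exp (u (k + 1))
        = (∑ k ∈ Finset.range n, (1 / 2 : ℝ) ^ (k + 1) * Real.exp (u (k + 1))) / 2 := by
      rw [Finset.sum_div]
      exact Finset.sum_congr rfl fun k _ => by ring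
    have hc : Real.exp ((1 / 2 : ℝ) • A + (1 / 2 : ℝ) • u 0)
        ≤ (1 / 2 : ℝ) • Real.exp A + (1 / 2 : ℝ) • Real.exp (u 0) :=
      convexOn_exp.2 (Set.mem_univ _) (Set.mem_univ _) (by norm_num) (by norm_num) (by norm_num)
    simp only [smul_eq_mul] at hc
    rw [hA, hE]
    have : A / 2 + (1 / 2) ^ (0 + 1) * u 0 = 1 / 2 * A + 1 / 2 * u 0 := by ring
    rw [this, pow_succ (1 / 2 : ℝ) n]
    norm_num at hc h ⊢
    linarith

theorem abs_signedSum_le {ι : Type*} [Fintype ι] (σ : ι → Bool) (v : ι → ℝ) :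
    |signedSum σ v| ≤ Real.sqrt (Fintype.card ι * ∑ i, v i ^ 2) := by
  refine Real.abs_le_sqrt ?_
  have h := Finset.sum_mul_sq_le_sq_mul_sq Finset.univ (fun i => boolSign (σ i)) v
  have h1 : ∀ b, boolSign b ^ 2 = 1 := fun b => by rw [← sq_abs, abs_boolSign]; norm_num
  simpa [h1, signedSum] using h

/-- Exponential moments of a signed process that is a sum of links from finite sets. -/
theorem chaining_of_links {ι R : Type*} [Fintype ι] [DecidableEq ι] (F : Finset R) (a : R → ι → ℝ)
    (P : ℕ → Finset (ι → ℝ)) {D V c : ℝ} (hc : 0 ≤ c) (hD : 0 ≤ D) (hV : 0 ≤ V)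
    (hcard : ∀ k, ((P k).card : ℝ) ≤ Real.exp (D * (2 * k + 1)))
    (hvar : ∀ k, ∀ v ∈ P k, ∑ i, v i ^ 2 ≤ 10 * V * (1 / 4) ^ k)
    (hlink : ∀ r ∈ F, ∀ n, ∃ v : ℕ → ι → ℝ, (∀ k, v k ∈ P k) ∧
      ∑ i, (a r i - ∑ k ∈ Finset.range (n + 1), v k i) ^ 2 ≤ V * (1 / 4) ^ n) :
    ∃ Ψ : (ι → Bool) → ℝ, (∀ σ, ∀ r ∈ F, Real.exp (c * |signedSum σ (a r)|) ≤ Ψ σ) ∧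
      ∑ σ, Ψ σ ≤ 2 ^ Fintype.card ι * Real.exp (2 + 3 * D + 20 * c ^ 2 * V) := by
  classical
  set m : ℝ := (Fintype.card ι : ℝ) with hm
  have hm0 : 0 ≤ m := by positivity
  obtain ⟨n, hn⟩ : ∃ n : ℕ, c * Real.sqrt (m * V) * (1 / 2) ^ n ≤ 1 / 4 := by
    have : Filter.Tendsto (fun n : ℕ => c * Real.sqrt (m * V) * (1 / 2 : ℝ) ^ n) Filter.atTop
        (nhds (c * Real.sqrt (m * V) * 0)) :=
      (tendsto_pow_atTop_nhds_zero_of_lt_one (by norm_num) (by norm_num)).const_mul _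
    rw [mul_zero] at this
    exact (this.eventually (ge_mem_nhds (by norm_num : (0 : ℝ) < 1 / 4))).exists
  set w : ℕ → ℝ := fun k => (1 / 2 : ℝ) ^ (k + 1) with hw
  have hw0 : ∀ k, 0 < w k := fun k => by positivity
  set b : ℕ → ℝ := fun k => Real.log 2 + D * (2 * k + 1) + 20 * c ^ 2 * V with hb
  set S : ℕ → (ι → Bool) → ℝ := fun k σ => ∑ v ∈ P k, Real.exp (c / w k * |signedSum σ v|)
    with hS
  have hSsum : ∀ k, ∑ σ, S k σ ≤ 2 ^ Fintype.card ι * Real.exp (b k) := by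
    intro k
    rw [hS, Finset.sum_comm]
    calc ∑ v ∈ P k, ∑ σ : ι → Bool, Real.exp (c / w k * |signedSum σ v|)
        ≤ ∑ v ∈ P k, 2 ^ Fintype.card ι * (2 * Real.exp (20 * c ^ 2 * V)) := by
          refine Finset.sum_le_sum fun v hv => (sum_exp_abs_signedSum_le v _).trans ?_
          gcongr
          have h := hvar k v hv
          calc (c / w k) ^ 2 * (∑ i, v i ^ 2) / 2
              ≤ (c / w k) ^ 2 * (10 * V * (1 / 4) ^ k) / 2 := by gcongr
            _ = 20 * c ^ 2 * V := by
              rw [hw]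
              have : ((1 / 4 : ℝ)) ^ k = ((1 / 2) ^ k) ^ 2 := by
                rw [← pow_mul, mul_comm, pow_mul]; norm_num
              rw [this, div_pow, pow_succ]
              field_simp
              ring
      _ = ((P k).card : ℝ) * (2 ^ Fintype.card ι * (2 * Real.exp (20 * c ^ 2 * V))) := by
          rw [Finset.sum_const, nsmul_eq_mul]
      _ ≤ Real.exp (D * (2 * k + 1)) * (2 ^ Fintype.card ι * (2 * Real.exp (20 * c ^ 2 * V))) := by
          gcongr; exact hcard k
      _ = 2 ^ Fintype.card ι * Real.exp (b k) := by
          rw [hb]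
          simp only
          rw [Real.exp_add, Real.exp_add, Real.exp_log (by norm_num)]
          ring
  have hbsum : ∑ k ∈ Finset.range (n + 1), w k * b k ≤ Real.log 2 + 3 * D + 20 * c ^ 2 * V := by
    have h1 : ∑ k ∈ Finset.range (n + 1), w k * b k
        = (Real.log 2 + 20 * c ^ 2 * V) * ∑ k ∈ Finset.range (n + 1), w k
          + D * ∑ k ∈ Finset.range (n + 1), w k * (2 * k + 1) := by
      rw [Finset.mul_sum, Finset.mul_sum, ← Finset.sum_add_distrib]
      exact Finset.sum_congr rfl fun k _ => by rw [hb]; ring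
    rw [h1, hw, sum_half_pow, sum_half_pow_mul]
    have hl : 0 ≤ Real.log 2 + 20 * c ^ 2 * V := by
      have := Real.log_nonneg (by norm_num : (1 : ℝ) ≤ 2)
      positivity
    have hp : (0 : ℝ) ≤ (1 / 2) ^ (n + 1) := by positivity
    have hq : (0 : ℝ) ≤ (2 * ((n + 1 : ℕ) : ℝ) + 3) * (1 / 2) ^ (n + 1) := by positivity
    nlinarith [mul_nonneg hl hp, mul_nonneg hD hq]
  refine ⟨fun σ => Real.exp (1 / 4 + (Real.log 2 + 3 * D + 20 * c ^ 2 * V)) *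
    (∑ k ∈ Finset.range (n + 1), w k * (Real.exp (-b k) * S k σ) + (1 / 2) ^ (n + 1)), ?_, ?_⟩
  · intro σ r hr
    obtain ⟨v, hv, hres⟩ := hlink r hr n
    have hdecomp : |signedSum σ (a r)| ≤ Real.sqrt (m * V) * (1 / 2) ^ n
        + ∑ k ∈ Finset.range (n + 1), |signedSum σ (v k)| := by
      have h1 : signedSum σ (a r)
          = signedSum σ (fun i => a r i - ∑ k ∈ Finset.range (n + 1), v k i)
            + ∑ k ∈ Finset.range (n + 1), signedSum σ (v k) := by
        simp only [signedSum]
        rw [Finset.sum_comm, ← Finset.sum_add_distrib]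
        refine Finset.sum_congr rfl fun i _ => ?_
        rw [← Finset.mul_sum]; ring
      have h2 := abs_signedSum_le σ (fun i => a r i - ∑ k ∈ Finset.range (n + 1), v k i)
      have h3 : Real.sqrt (m * ∑ i, (a r i - ∑ k ∈ Finset.range (n + 1), v k i) ^ 2)
          ≤ Real.sqrt (m * V) * (1 / 2) ^ n := by
        calc _ ≤ Real.sqrt (m * V * ((1 / 2) ^ n) ^ 2) := by
              refine Real.sqrt_le_sqrt ?_
              rw [mul_assoc]
              refine mul_le_mul_of_nonneg_left (hres.trans (le_of_eq ?_)) hm0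
              rw [← pow_mul, mul_comm n 2, pow_mul]; norm_num
          _ = _ := by
              rw [Real.sqrt_mul (by positivity), Real.sqrt_sq (by positivity)]
      rw [h1]
      exact (abs_add_le _ _).trans
        (add_le_add (h2.trans h3) (Finset.abs_sum_le_sum_abs _ _))
    have hexp : c * |signedSum σ (a r)| ≤ 1 / 4 + (Real.log 2 + 3 * D + 20 * c ^ 2 * V)
        + ∑ k ∈ Finset.range (n + 1), w k * (c / w k * |signedSum σ (v k)| - b k) := by
      have h1 : ∑ k ∈ Finset.range (n + 1), w k * (c / w k * |signedSum σ (v k)| - b k)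
          = c * ∑ k ∈ Finset.range (n + 1), |signedSum σ (v k)|
            - ∑ k ∈ Finset.range (n + 1), w k * b k := by
        rw [Finset.mul_sum, ← Finset.sum_sub_distrib]
        refine Finset.sum_congr rfl fun k _ => ?_
        have := (hw0 k).ne'
        field_simp
      have h2 := mul_le_mul_of_nonneg_left hdecomp hc
      rw [h1]
      linarith
    refine (Real.exp_le_exp.2 hexp).trans ?_
    rw [Real.exp_add]
    refine mul_le_mul_of_nonneg_left ((exp_sum_half_pow_le _ _).trans ?_) (Real.exp_pos _).le
    gcongr with k hk
    rw [sub_eq_neg_add, Real.exp_add]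
    refine mul_le_mul_of_nonneg_left ?_ (Real.exp_pos _).le
    exact Finset.single_le_sum (f := fun u => Real.exp (c / w k * |signedSum σ u|))
      (fun _ _ => (Real.exp_pos _).le) (hv k)
  · rw [← Finset.mul_sum, Finset.sum_add_distrib, Finset.sum_comm]
    have h1 : ∑ k ∈ Finset.range (n + 1), ∑ σ, w k * (Real.exp (-b k) * S k σ)
        ≤ ∑ k ∈ Finset.range (n + 1), w k * 2 ^ Fintype.card ι := by
      refine Finset.sum_le_sum fun k _ => ?_
      rw [← Finset.mul_sum, ← Finset.mul_sum]
      refine mul_le_mul_of_nonneg_left ?_ (hw0 k).le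
      calc Real.exp (-b k) * ∑ σ, S k σ
          ≤ Real.exp (-b k) * (2 ^ Fintype.card ι * Real.exp (b k)) := by
            gcongr; exact hSsum k
        _ = 2 ^ Fintype.card ι * (Real.exp (-b k) * Real.exp (b k)) := by ring
        _ = _ := by rw [← Real.exp_add]; simp
    have h2 : ∑ σ : ι → Bool, (1 / 2 : ℝ) ^ (n + 1) = 2 ^ Fintype.card ι * (1 / 2) ^ (n + 1) := by
      simp
    have h3 : ∑ k ∈ Finset.range (n + 1), w k * (2 : ℝ) ^ Fintype.card ι
        = 2 ^ Fintype.card ι * (1 - (1 / 2) ^ (n + 1)) := by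
      rw [← Finset.sum_mul, hw, sum_half_pow, mul_comm]
    rw [h3] at h1
    rw [h2]
    have hlog := Real.log_two_lt_d9
    calc _ ≤ Real.exp (1 / 4 + (Real.log 2 + 3 * D + 20 * c ^ 2 * V)) * 2 ^ Fintype.card ι :=
          mul_le_mul_of_nonneg_left (by linarith) (Real.exp_pos _).le
      _ ≤ Real.exp (2 + 3 * D + 20 * c ^ 2 * V) * 2 ^ Fintype.card ι := by
          refine mul_le_mul_of_nonneg_right (Real.exp_le_exp.2 ?_) (by positivity)
          linarith
      _ = _ := mul_comm _ _

/-- **Chaining**: exponential moments of a signed process with small nets at all scales. -/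
theorem chaining {ι R : Type*} [Fintype ι] [DecidableEq ι] (F : Finset R) (a : R → ι → ℝ)
    {D V c : ℝ} (hc : 0 ≤ c) (hD : 0 ≤ D) (hV : 0 ≤ V)
    (hbdd : ∀ r ∈ F, ∑ i, a r i ^ 2 ≤ V)
    (hnet : ∀ k : ℕ, ∃ T ⊆ F, (T.card : ℝ) ≤ Real.exp (D * (k + 1)) ∧
      ∀ r ∈ F, ∃ s ∈ T, ∑ i, (a r i - a s i) ^ 2 ≤ V * (1 / 4) ^ k) :
    ∃ Ψ : (ι → Bool) → ℝ, (∀ σ, ∀ r ∈ F, Real.exp (c * |signedSum σ (a r)|) ≤ Ψ σ) ∧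
      ∑ σ, Ψ σ ≤ 2 ^ Fintype.card ι * Real.exp (2 + 3 * D + 20 * c ^ 2 * V) := by
  classical
  choose T hTF hTc hTn using hnet
  let P : ℕ → Finset (ι → ℝ) := fun k => match k with
    | 0 => (T 0).image a
    | k + 1 => ((T (k + 1) ×ˢ T k).image fun p => a p.1 - a p.2).filter
        fun v => ∑ i, v i ^ 2 ≤ 10 * V * (1 / 4) ^ (k + 1)
  refine chaining_of_links F a P hc hD hV ?_ ?_ ?_
  · intro k
    cases k with
    | zero =>
      refine le_trans ?_ ((hTc 0).trans (le_of_eq ?_))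
      · exact_mod_cast Finset.card_image_le
      · simp
    | succ k =>
      have h1 : (P (k + 1)).card ≤ (T (k + 1)).card * (T k).card :=
        (Finset.card_filter_le _ _).trans (Finset.card_image_le.trans (Finset.card_product _ _).le)
      calc ((P (k + 1)).card : ℝ) ≤ (T (k + 1)).card * (T k).card := by exact_mod_cast h1
        _ ≤ Real.exp (D * ((k + 1 : ℕ) + 1)) * Real.exp (D * (k + 1)) := by
            gcongr <;> apply hTc
        _ = _ := by rw [← Real.exp_add]; congr 1; push_cast; ring
  · intro k v hv
    cases k with
    | zero =>
      obtain ⟨r, hr, rfl⟩ := Finset.mem_image.1 hv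
      have := hbdd r (hTF 0 hr)
      simp only [pow_zero, mul_one]
      linarith
    | succ k => exact (Finset.mem_filter.1 hv).2
  · intro r hr n
    choose t htT ht using fun k => hTn k r hr
    refine ⟨fun k => match k with
      | 0 => a (t 0)
      | k + 1 => a (t (k + 1)) - a (t k), ?_, ?_⟩
    · intro k
      cases k with
      | zero => exact Finset.mem_image_of_mem _ (htT 0)
      | succ k =>
        refine Finset.mem_filter.2 ⟨Finset.mem_image.2 ⟨(t (k + 1), t k),
          Finset.mem_product.2 ⟨htT _, htT _⟩, rfl⟩, ?_⟩
        calc ∑ i, (a (t (k + 1)) i - a (t k) i) ^ 2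
            ≤ ∑ i, (2 * (a r i - a (t (k + 1)) i) ^ 2 + 2 * (a r i - a (t k) i) ^ 2) := by
              refine Finset.sum_le_sum fun i _ => ?_
              nlinarith [sq_nonneg ((a r i - a (t (k + 1)) i) + (a r i - a (t k) i))]
          _ ≤ 2 * (V * (1 / 4) ^ (k + 1)) + 2 * (V * (1 / 4) ^ k) := by
              rw [Finset.sum_add_distrib, ← Finset.mul_sum, ← Finset.mul_sum]
              linarith [ht k, ht (k + 1)]
          _ = _ := by ring
    · have : ∀ i, ∑ k ∈ Finset.range (n + 1), (match k with
          | 0 => a (t 0)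
          | k + 1 => a (t (k + 1)) - a (t k) : ι → ℝ) i = a (t n) i := by
        intro i
        induction n with
        | zero => simp
        | succ n ih => rw [Finset.sum_range_succ, ih]; simp
      simp only [this]
      exact ht n

/-- Swap the two entries of a pair if the sign is negative. -/
def condSwap {Z : Type*} (b : Bool) (p : Z × Z) : Z × Z := if b then p else p.swap

theorem measurePreserving_condSwap {Z : Type*} [MeasurableSpace Z] (P : Measure Z) [SFinite P]
    (b : Bool) : MeasurePreserving (condSwap b) (P.prod P) (P.prod P) := by
  cases b
  · exact Measure.measurePreserving_swap
  · exact MeasurePreserving.id _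

/-- **Symmetrization**: uniform deviations of empirical means, controlled by exponential moments of
signed sums. -/
theorem measure_exists_abs_sum_sub_gt_le {Z R : Type*} [MeasurableSpace Z] (P : Measure Z)
    [IsProbabilityMeasure P] (m : ℕ) (F : Finset R) (g : R → Z → ℝ) {W c Q t : ℝ}
    (hg : ∀ r, Measurable (g r)) (hgW : ∀ r z, |g r z| ≤ W) (hc : 0 ≤ c)
    (h : ∀ z z' : Fin m → Z, ∃ Ψ : (Fin m → Bool) → ℝ,
      (∀ σ, ∀ r ∈ F, Real.exp (c * |signedSum σ fun i => g r (z i) - g r (z' i)|) ≤ Ψ σ) ∧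
        ∑ σ, Ψ σ ≤ 2 ^ m * Q) :
    (Measure.pi fun _ : Fin m => P)
        {z | ∃ r ∈ F, t < |∑ i, (g r (z i) - ∫ x, g r x ∂P)|}
      ≤ ENNReal.ofReal (Real.exp (-(c * t)) * Q) := by
  classical
  rcases F.eq_empty_or_nonempty with rfl | hF
  · simp
  set Pm := Measure.pi fun _ : Fin m => P with hPm
  set X : R → (Fin m → Z) → (Fin m → Z) → ℝ := fun r z z' => ∑ i, (g r (z i) - g r (z' i)) with hX
  have hXm : ∀ r, Measurable fun w : (Fin m → Z) × (Fin m → Z) => X r w.1 w.2 := by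
    intro r
    refine Finset.measurable_sum _ fun i _ => ?_
    exact ((hg r).comp ((measurable_pi_apply i).comp measurable_fst)).sub
      ((hg r).comp ((measurable_pi_apply i).comp measurable_snd))
  set G : (Fin m → Z) × (Fin m → Z) → ℝ := fun w =>
    F.sup' hF fun r => Real.exp (c * |X r w.1 w.2|) with hG
  have hGm : Measurable G := by
    have := Finset.measurable_sup' hF
      (f := fun r (w : (Fin m → Z) × (Fin m → Z)) => Real.exp (c * |X r w.1 w.2|))
      (fun r _ => (((hXm r).abs).const_mul c).exp)
    convert this using 1
    ext w
    simp [hG, Finset.sup'_apply]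
  have hXb : ∀ r z z', |X r z z'| ≤ m * (2 * W) := by
    intro r z z'
    refine (Finset.abs_sum_le_sum_abs _ _).trans ?_
    calc ∑ i, |g r (z i) - g r (z' i)| ≤ ∑ _i : Fin m, 2 * W := by
          refine Finset.sum_le_sum fun i _ => (abs_sub _ _).trans ?_
          linarith [hgW r (z i), hgW r (z' i)]
      _ = _ := by simp
  have hG0 : ∀ w, 0 ≤ G w := fun w =>
    (Real.exp_pos _).le.trans (Finset.le_sup' (fun r => Real.exp (c * |X r w.1 w.2|)) hF.choose_spec)
  have hGb : ∀ w, G w ≤ Real.exp (c * (m * (2 * W))) := fun w =>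
    Finset.sup'_le _ _ fun r _ => Real.exp_le_exp.2 (mul_le_mul_of_nonneg_left (hXb _ _ _) hc)
  have hGi : ∀ z, Integrable (fun z' => G (z, z')) Pm := fun z =>
    Integrable.of_bound (hGm.comp measurable_prodMk_left).aestronglyMeasurable _
      (Filter.Eventually.of_forall fun z' => by
        rw [Real.norm_of_nonneg (hG0 _)]; exact hGb _)
  -- Jensen's inequality for the second half of the sample
  have hjensen : ∀ z, ∀ r ∈ F,
      Real.exp (c * |∑ i, (g r (z i) - ∫ x, g r x ∂P)|) ≤ ∫ z', G (z, z') ∂Pm := by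
    intro z r hr
    have hgi : ∀ i : Fin m, Integrable (fun z' : Fin m → Z => g r (z' i)) Pm := fun i =>
      Integrable.of_bound ((hg r).comp (measurable_pi_apply i)).aestronglyMeasurable W
        (Filter.Eventually.of_forall fun z' => hgW r _)
    have hmean : ∑ i, (g r (z i) - ∫ x, g r x ∂P) = ∫ z', X r z z' ∂Pm := by
      simp only [hX]
      have hsub : ∀ i, Integrable (fun z' : Fin m → Z => g r (z i) - g r (z' i)) Pm :=
        fun i => (integrable_const (g r (z i))).sub (hgi i)
      rw [integral_finsetSum _ fun i _ => hsub i]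
      refine Finset.sum_congr rfl fun i _ => ?_
      rw [integral_sub (integrable_const _) (hgi i),
        integral_comp_eval (hg r).aestronglyMeasurable]
      simp
    have hXi : Integrable (fun z' => Real.exp (c * |X r z z'|)) Pm :=
      Integrable.of_bound
        ((((hXm r).comp measurable_prodMk_left).abs.const_mul c).exp).aestronglyMeasurable
        (Real.exp (c * (m * (2 * W)))) (Filter.Eventually.of_forall fun z' => by
          rw [Real.norm_of_nonneg (Real.exp_pos _).le]
          exact Real.exp_le_exp.2 (mul_le_mul_of_nonneg_left (hXb _ _ _) hc))
    have hXi' : Integrable (fun z' => c * |X r z z'|) Pm :=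
      Integrable.of_bound
        (((hXm r).comp measurable_prodMk_left).abs.const_mul c).aestronglyMeasurable
        (c * (m * (2 * W))) (Filter.Eventually.of_forall fun z' => by
          rw [Real.norm_of_nonneg (by positivity)]
          exact mul_le_mul_of_nonneg_left (hXb _ _ _) hc)
    calc Real.exp (c * |∑ i, (g r (z i) - ∫ x, g r x ∂P)|)
        ≤ Real.exp (∫ z', c * |X r z z'| ∂Pm) := by
          rw [hmean, integral_const_mul]
          gcongr
          exact abs_integral_le_integral_abs
      _ ≤ ∫ z', Real.exp (c * |X r z z'|) ∂Pm :=
          convexOn_exp.map_integral_le Real.continuous_exp.continuousOn isClosed_univ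
            (Filter.Eventually.of_forall fun _ => Set.mem_univ _) hXi' hXi
      _ ≤ _ := integral_mono hXi (hGi z) fun z' =>
          Finset.le_sup' (fun r => Real.exp (c * |X r z z'|)) hr
  set I := ∫⁻ z, ∫⁻ z', ENNReal.ofReal (G (z, z')) ∂Pm ∂Pm with hI
  have hsymm : 2 ^ m * I ≤ 2 ^ m * ENNReal.ofReal Q := by
    have he := measurePreserving_arrowProdEquivProdArrow Z Z (Fin m) (fun _ => P) (fun _ => P)
    have hI' : ∀ σ : Fin m → Bool, I = ∫⁻ v : Fin m → Z × Z, ENNReal.ofReal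
        (G (fun i => (condSwap (σ i) (v i)).1, fun i => (condSwap (σ i) (v i)).2))
          ∂Measure.pi fun _ => P.prod P := by
      intro σ
      have hs := measurePreserving_pi (fun _ : Fin m => P.prod P) (fun _ : Fin m => P.prod P)
        (f := fun i => condSwap (σ i)) fun i => measurePreserving_condSwap P (σ i)
      rw [hI, ← lintegral_prod _ hGm.ennreal_ofReal.aemeasurable]
      exact ((he.comp hs).lintegral_comp hGm.ennreal_ofReal).symm
    have hsum : 2 ^ m * I = ∑ σ : Fin m → Bool, ∫⁻ v : Fin m → Z × Z, ENNReal.ofReal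
        (G (fun i => (condSwap (σ i) (v i)).1, fun i => (condSwap (σ i) (v i)).2))
          ∂Measure.pi fun _ => P.prod P := by
      rw [← Finset.sum_congr rfl fun σ _ => hI' σ]
      simp
    have hmeas : ∀ σ : Fin m → Bool, Measurable fun v : Fin m → Z × Z => ENNReal.ofReal
        (G (fun i => (condSwap (σ i) (v i)).1, fun i => (condSwap (σ i) (v i)).2)) := by
      intro σ
      have hs := measurePreserving_pi (fun _ : Fin m => P.prod P) (fun _ : Fin m => P.prod P)
        (f := fun i => condSwap (σ i)) fun i => measurePreserving_condSwap P (σ i)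
      exact hGm.ennreal_ofReal.comp (he.comp hs).measurable
    rw [hsum, ← lintegral_finsetSum _ fun σ _ => hmeas σ]
    calc _ ≤ ∫⁻ _v : Fin m → Z × Z, 2 ^ m * ENNReal.ofReal Q ∂Measure.pi fun _ => P.prod P := by
          refine lintegral_mono fun v => ?_
          simp only
          rw [← ENNReal.ofReal_sum_of_nonneg fun σ _ => hG0 _]
          have h2 : (2 : ENNReal) ^ m * ENNReal.ofReal Q = ENNReal.ofReal (2 ^ m * Q) := by
            rw [ENNReal.ofReal_mul (by positivity), ENNReal.ofReal_pow (by norm_num)]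
            simp
          rw [h2]
          refine ENNReal.ofReal_le_ofReal ?_
          obtain ⟨Ψ, hΨ, hΨs⟩ := h (fun i => (v i).1) (fun i => (v i).2)
          refine le_trans (Finset.sum_le_sum fun σ _ => ?_) hΨs
          refine Finset.sup'_le _ _ fun r hr => ?_
          refine le_trans (le_of_eq ?_) (hΨ σ r hr)
          congr 3
          refine Finset.sum_congr rfl fun i _ => ?_
          cases hσ : σ i <;> simp [condSwap, boolSign, hσ]
      _ = _ := by simp
  have hIQ : I ≤ ENNReal.ofReal Q :=
    (ENNReal.mul_le_mul_iff_right (by positivity) (by finiteness)).1 hsymm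
  have hmarkov := mul_meas_ge_le_lintegral (μ := Pm)
    (f := fun z => ∫⁻ z', ENNReal.ofReal (G (z, z')) ∂Pm)
    (hGm.ennreal_ofReal.lintegral_prod_right') (ENNReal.ofReal (Real.exp (c * t)))
  have hsub : {z | ∃ r ∈ F, t < |∑ i, (g r (z i) - ∫ x, g r x ∂P)|} ⊆
      {z | ENNReal.ofReal (Real.exp (c * t)) ≤ ∫⁻ z', ENNReal.ofReal (G (z, z')) ∂Pm} := by
    rintro z ⟨r, hr, hz⟩
    change _ ≤ ∫⁻ z', ENNReal.ofReal (G (z, z')) ∂Pm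
    rw [← ofReal_integral_eq_lintegral_ofReal (hGi z)
      (Filter.Eventually.of_forall fun z' => hG0 _)]
    refine ENNReal.ofReal_le_ofReal (le_trans ?_ (hjensen z r hr))
    gcongr
  have h1 : ENNReal.ofReal (Real.exp (c * t)) *
      Pm {z | ∃ r ∈ F, t < |∑ i, (g r (z i) - ∫ x, g r x ∂P)|} ≤ ENNReal.ofReal Q :=
    (mul_le_mul_right (measure_mono hsub) _).trans (hmarkov.trans hIQ)
  have h2 : ENNReal.ofReal (Real.exp (-(c * t))) * ENNReal.ofReal (Real.exp (c * t)) = 1 := by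
    rw [← ENNReal.ofReal_mul (Real.exp_pos _).le, ← Real.exp_add]
    simp
  calc Pm {z | ∃ r ∈ F, t < |∑ i, (g r (z i) - ∫ x, g r x ∂P)|}
      = ENNReal.ofReal (Real.exp (-(c * t))) * (ENNReal.ofReal (Real.exp (c * t)) *
        Pm {z | ∃ r ∈ F, t < |∑ i, (g r (z i) - ∫ x, g r x ∂P)|}) := by
        rw [← mul_assoc, h2, one_mul]
    _ ≤ ENNReal.ofReal (Real.exp (-(c * t))) * ENNReal.ofReal Q := mul_le_mul_right h1 _
    _ = _ := (ENNReal.ofReal_mul (Real.exp_pos _).le).symm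

theorem sum_toReal_eq_one {α : Type*} [Fintype α] (p : PMF α) : ∑ a, (p a).toReal = 1 := by
  rw [← ENNReal.toReal_sum fun a _ => p.apply_ne_top a, ← tsum_fintype (L := .unconditional α),
    p.tsum_coe]
  rfl

/-- The normalization `∑ z, π_ref(z | x) exp(r(x, z) / β)` of the policy induced by `r`. -/
noncomputable def partitionFunction {N K : ℕ} (πref : Fin N → PMF (Fin K)) (β : ℝ)
    (r : Table N K) (x : Fin N) : ℝ :=
  ∑ z, (πref x z).toReal * Real.exp (r x z / β)

/-- The density of the policy induced by `r` with respect to the reference policy. -/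
noncomputable def policyRatio {N K : ℕ} (πref : Fin N → PMF (Fin K)) (β : ℝ) (r : Table N K)
    (x : Fin N) (y : Fin K) : ℝ :=
  Real.exp (r x y / β) / partitionFunction πref β r x

theorem policy_eq {N K : ℕ} (πref : Fin N → PMF (Fin K)) (β : ℝ) (r : Table N K) (x : Fin N)
    (y : Fin K) : policy πref β r x y = (πref x y).toReal * policyRatio πref β r x y := by
  rw [policy, policyRatio, partitionFunction, mul_div_assoc]

theorem exp_div_mem {β B u : ℝ} (hβ : 0 < β) (hu : |u| ≤ B) :
    (Real.exp (B / β))⁻¹ ≤ Real.exp (u / β) ∧ Real.exp (u / β) ≤ Real.exp (B / β) := by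
  rw [abs_le] at hu
  rw [← Real.exp_neg, ← neg_div]
  constructor <;> gcongr
  exacts [hu.1, hu.2]

theorem abs_exp_div_sub_le {β B u v : ℝ} (hβ : 0 < β) (hu : |u| ≤ B) (hv : |v| ≤ B) :
    |Real.exp (u / β) - Real.exp (v / β)| ≤ Real.exp (B / β) / β * |u - v| := by
  wlog h : v ≤ u generalizing u v
  · rw [abs_sub_comm, abs_sub_comm u]
    exact this hv hu (le_of_not_ge h)
  rw [abs_of_nonneg (sub_nonneg.2 (by gcongr)), abs_of_nonneg (sub_nonneg.2 h)]
  have h1 : Real.exp (v / β) = Real.exp (u / β) * Real.exp (v / β - u / β) := by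
    rw [← Real.exp_add]; congr 1; ring
  have h2 := Real.add_one_le_exp (v / β - u / β)
  calc Real.exp (u / β) - Real.exp (v / β)
      = Real.exp (u / β) * (1 - Real.exp (v / β - u / β)) := by rw [h1]; ring
    _ ≤ Real.exp (u / β) * ((u - v) / β) := by
        gcongr
        rw [sub_div]; linarith
    _ ≤ Real.exp (B / β) * ((u - v) / β) := by
        gcongr
        exact (abs_le.1 hu).2
    _ = _ := by ring

theorem partitionFunction_mem {N K : ℕ} (πref : Fin N → PMF (Fin K)) {β B : ℝ} (hβ : 0 < β)
    {r : Table N K} (hr : ∀ x y, |r x y| ≤ B) (x : Fin N) :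
    (Real.exp (B / β))⁻¹ ≤ partitionFunction πref β r x ∧
      partitionFunction πref β r x ≤ Real.exp (B / β) := by
  have h := sum_toReal_eq_one (πref x)
  constructor
  · calc (Real.exp (B / β))⁻¹ = ∑ z, (πref x z).toReal * (Real.exp (B / β))⁻¹ := by
          rw [← Finset.sum_mul, h, one_mul]
      _ ≤ _ := Finset.sum_le_sum fun z _ =>
          mul_le_mul_of_nonneg_left (exp_div_mem hβ (hr x z)).1 ENNReal.toReal_nonneg
  · calc partitionFunction πref β r x ≤ ∑ z, (πref x z).toReal * Real.exp (B / β) :=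
          Finset.sum_le_sum fun z _ =>
            mul_le_mul_of_nonneg_left (exp_div_mem hβ (hr x z)).2 ENNReal.toReal_nonneg
      _ = Real.exp (B / β) := by rw [← Finset.sum_mul, h, one_mul]

theorem policyRatio_mem {N K : ℕ} (πref : Fin N → PMF (Fin K)) {β B : ℝ} (hβ : 0 < β)
    {r : Table N K} (hr : ∀ x y, |r x y| ≤ B) (x : Fin N) (y : Fin K) :
    0 ≤ policyRatio πref β r x y ∧ policyRatio πref β r x y ≤ Real.exp (B / β) ^ 2 := by
  have hE := Real.exp_pos (B / β)
  have hZ := partitionFunction_mem πref hβ hr x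
  have hZ0 : 0 < partitionFunction πref β r x := (inv_pos.2 hE).trans_le hZ.1
  refine ⟨by rw [policyRatio]; positivity, ?_⟩
  rw [policyRatio, div_le_iff₀ hZ0]
  calc Real.exp (r x y / β) ≤ Real.exp (B / β) := (exp_div_mem hβ (hr x y)).2
    _ = Real.exp (B / β) ^ 2 * (Real.exp (B / β))⁻¹ := by field_simp
    _ ≤ _ := by gcongr; exact hZ.1

/-- The density of the induced policy is a Lipschitz function of the reward. -/
theorem abs_policyRatio_sub_le {N K : ℕ} (πref : Fin N → PMF (Fin K)) {β B : ℝ} (hβ : 0 < β)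
    {r s : Table N K} (hr : ∀ x y, |r x y| ≤ B) (hs : ∀ x y, |s x y| ≤ B) (x : Fin N)
    (y : Fin K) :
    |policyRatio πref β r x y - policyRatio πref β s x y| ≤ Real.exp (B / β) ^ 4 / β *
      (|r x y - s x y| + ∑ z, (πref x z).toReal * |r x z - s x z|) := by
  set E := Real.exp (B / β) with hEdef
  have hE : 0 < E := Real.exp_pos _
  have hZr := partitionFunction_mem πref hβ hr x
  have hZs := partitionFunction_mem πref hβ hs x
  rw [← hEdef] at hZr hZs
  set Zr := partitionFunction πref β r x with hZrd
  set Zs := partitionFunction πref β s x with hZsd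
  have hr0 : 0 < Zr := (inv_pos.2 hE).trans_le hZr.1
  have hs0 : 0 < Zs := (inv_pos.2 hE).trans_le hZs.1
  set δ := ∑ z, (πref x z).toReal * |r x z - s x z| with hδ
  have hδ0 : 0 ≤ δ := Finset.sum_nonneg fun z _ => by positivity
  have hΔZ : |Zs - Zr| ≤ E / β * δ := by
    rw [abs_sub_comm, hZrd, hZsd, partitionFunction, partitionFunction, ← Finset.sum_sub_distrib,
      hδ, Finset.mul_sum]
    refine (Finset.abs_sum_le_sum_abs _ _).trans (Finset.sum_le_sum fun z _ => ?_)
    rw [← mul_sub, abs_mul, abs_of_nonneg ENNReal.toReal_nonneg]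
    calc _ ≤ (πref x z).toReal * (E / β * |r x z - s x z|) :=
          mul_le_mul_of_nonneg_left (abs_exp_div_sub_le hβ (hr x z) (hs x z))
            ENNReal.toReal_nonneg
      _ = _ := by ring
  have hΔe := abs_exp_div_sub_le hβ (hr x y) (hs x y)
  rw [← hEdef] at hΔe
  have hes := (exp_div_mem hβ (hs x y)).2
  rw [← hEdef] at hes
  have hkey : policyRatio πref β r x y - policyRatio πref β s x y
      = ((Real.exp (r x y / β) - Real.exp (s x y / β)) * Zs
        + Real.exp (s x y / β) * (Zs - Zr)) * (Zr⁻¹ * Zs⁻¹) := by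
    rw [policyRatio, policyRatio, ← hZrd, ← hZsd]
    field_simp
    ring
  have hri : Zr⁻¹ ≤ E := inv_le_of_inv_le₀ hE hZr.1
  have hsi : Zs⁻¹ ≤ E := inv_le_of_inv_le₀ hE hZs.1
  rw [hkey, abs_mul, abs_of_pos (mul_pos (inv_pos.2 hr0) (inv_pos.2 hs0))]
  have h1 : |(Real.exp (r x y / β) - Real.exp (s x y / β)) * Zs
      + Real.exp (s x y / β) * (Zs - Zr)| ≤ E / β * |r x y - s x y| * E + E * (E / β * δ) := by
    refine (abs_add_le _ _).trans ?_
    rw [abs_mul, abs_mul, abs_of_pos hs0, abs_of_pos (Real.exp_pos _)]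
    gcongr
    exact hZs.2
  calc _ ≤ (E / β * |r x y - s x y| * E + E * (E / β * δ)) * (E * E) := by gcongr
    _ = _ := by ring

/-- The importance weighted score of a labelled example, with the score clipped to `[0, 1]`. -/
noncomputable def weightedScore {N K : ℕ} (πref : Fin N → PMF (Fin K)) (β : ℝ) (r : Table N K)
    (e : Example N K) : ℝ :=
  policyRatio πref β r e.1 e.2.1 * max 0 (min e.2.2 1)

theorem measurable_weightedScore {N K : ℕ} (πref : Fin N → PMF (Fin K)) (β : ℝ)
    (r : Table N K) : Measurable (weightedScore πref β r) := by
  refine Measurable.mul ?_ (by fun_prop)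
  have : Measurable fun c : Fin N × Fin K => policyRatio πref β r c.1 c.2 :=
    measurable_of_finite _
  exact this.comp (measurable_fst.prodMk (measurable_fst.comp measurable_snd))

theorem clip_mem (u : ℝ) : 0 ≤ max 0 (min u 1) ∧ max 0 (min u 1) ≤ 1 :=
  ⟨le_max_left _ _, max_le zero_le_one (min_le_right _ _)⟩

theorem weightedScore_mem {N K : ℕ} (πref : Fin N → PMF (Fin K)) {β B : ℝ} (hβ : 0 < β)
    {r : Table N K} (hr : ∀ x y, |r x y| ≤ B) (e : Example N K) :
    0 ≤ weightedScore πref β r e ∧ weightedScore πref β r e ≤ Real.exp (B / β) ^ 2 := by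
  have h1 := policyRatio_mem πref hβ hr e.1 e.2.1
  have h2 := clip_mem e.2.2
  exact ⟨mul_nonneg h1.1 h2.1, (mul_le_of_le_one_right h1.1 h2.2).trans h1.2⟩

open Classical in
/-- Weights on the cells that put half of the mass on the chain of an example, and half on all
chains of its problem. -/
noncomputable def cellWeight {N K : ℕ} (πref : Fin N → PMF (Fin K)) (e : Example N K)
    (c : Fin N × Fin K) : ℝ :=
  ((if c = (e.1, e.2.1) then 1 else 0) + if c.1 = e.1 then (πref e.1 c.2).toReal else 0) / 2

theorem cellWeight_nonneg {N K : ℕ} (πref : Fin N → PMF (Fin K)) (e : Example N K)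
    (c : Fin N × Fin K) : 0 ≤ cellWeight πref e c := by
  rw [cellWeight]
  split_ifs <;> positivity

theorem sum_cellWeight_mul {N K : ℕ} (πref : Fin N → PMF (Fin K)) (e : Example N K)
    (f : Fin N × Fin K → ℝ) :
    ∑ c, cellWeight πref e c * f c
      = (f (e.1, e.2.1) + ∑ z, (πref e.1 z).toReal * f (e.1, z)) / 2 := by
  classical
  have h1 : ∑ c : Fin N × Fin K, (if c = (e.1, e.2.1) then (1 : ℝ) else 0) * f c
      = f (e.1, e.2.1) := by simp
  have h2 : ∑ c : Fin N × Fin K, (if c.1 = e.1 then (πref e.1 c.2).toReal else 0) * f c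
      = ∑ z, (πref e.1 z).toReal * f (e.1, z) := by
    rw [Fintype.sum_prod_type, Finset.sum_eq_single e.1]
    · simp
    · intro x _ hx; simp [hx]
    · simp
  rw [← h1, ← h2, ← Finset.sum_add_distrib, Finset.sum_div]
  refine Finset.sum_congr rfl fun c _ => ?_
  rw [cellWeight]
  by_cases ha : c = (e.1, e.2.1) <;> by_cases hb : c.1 = e.1 <;> simp [ha, hb] <;> ring

theorem weightedDist_cellWeight {N K : ℕ} (πref : Fin N → PMF (Fin K)) (e : Example N K)
    (r s : Table N K) :
    weightedDist (cellWeight πref e) r s = (|r e.1 e.2.1 - s e.1 e.2.1|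
      + ∑ z, (πref e.1 z).toReal * |r e.1 z - s e.1 z|) / 2 :=
  sum_cellWeight_mul πref e fun c => |r c.1 c.2 - s c.1 c.2|

theorem sq_weightedScore_sub_le {N K : ℕ} (πref : Fin N → PMF (Fin K)) {β B : ℝ} (hβ : 0 < β)
    {r s : Table N K} (hr : ∀ x y, |r x y| ≤ B) (hs : ∀ x y, |s x y| ≤ B) (e : Example N K) :
    (weightedScore πref β r e - weightedScore πref β s e) ^ 2
      ≤ 8 * B * (Real.exp (B / β) ^ 4 / β) ^ 2 * weightedDist (cellWeight πref e) r s := by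
  set L := Real.exp (B / β) ^ 4 / β with hL
  have hL0 : 0 ≤ L := by positivity
  set w := weightedDist (cellWeight πref e) r s with hw
  have hb : ∀ x y, |r x y - s x y| ≤ 2 * B := fun x y =>
    (abs_sub _ _).trans (by linarith [hr x y, hs x y])
  have hw0 : 0 ≤ w := Finset.sum_nonneg fun c _ => mul_nonneg (cellWeight_nonneg _ _ _) (abs_nonneg _)
  have hwB : w ≤ 2 * B := by
    have : ∑ z, (πref e.1 z).toReal * |r e.1 z - s e.1 z| ≤ 2 * B := by
      calc _ ≤ ∑ z, (πref e.1 z).toReal * (2 * B) := Finset.sum_le_sum fun z _ =>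
            mul_le_mul_of_nonneg_left (hb _ _) ENNReal.toReal_nonneg
        _ = 2 * B := by rw [← Finset.sum_mul, sum_toReal_eq_one, one_mul]
    rw [hw, weightedDist_cellWeight]
    linarith [hb e.1 e.2.1]
  have h1 : |weightedScore πref β r e - weightedScore πref β s e| ≤ 2 * L * w := by
    rw [weightedScore, weightedScore, ← sub_mul, abs_mul, abs_of_nonneg (clip_mem _).1]
    refine (mul_le_of_le_one_right (abs_nonneg _) (clip_mem _).2).trans ?_
    refine (abs_policyRatio_sub_le πref hβ hr hs _ _).trans (le_of_eq ?_)
    rw [hw, weightedDist_cellWeight]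
    ring
  rw [← sq_abs]
  calc _ ≤ (2 * L * w) ^ 2 := by gcongr
    _ = 4 * L ^ 2 * w * w := by ring
    _ ≤ 4 * L ^ 2 * w * (2 * B) := by gcongr
    _ = _ := by ring

/-- Uniform deviation bound for the importance weighted scores. -/
theorem measure_exists_weightedScore_gt_le {N K d m : ℕ} (πref : Fin N → PMF (Fin K))
    {β B : ℝ} (hβ : 0 < β) {H : Set (Table N K)} (hH : rewardVCDim H ≤ d) (hd : 1 ≤ d)
    (hB : ∀ r ∈ H, ∀ x y, |r x y| ≤ B) (F : Finset (Table N K)) (hF : ∀ r ∈ F, r ∈ H)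
    (hm : 0 < m) (P : Measure (Example N K)) [IsProbabilityMeasure P] {c t V : ℝ} (hc : 0 ≤ c)
    (hV : V = Real.exp (B / β) ^ 4 + 64 * B ^ 2 * (Real.exp (B / β) ^ 4 / β) ^ 2) :
    (Measure.pi fun _ : Fin m => P) {z | ∃ r ∈ F,
        t < |∑ i, (weightedScore πref β r (z i) - ∫ e, weightedScore πref β r e ∂P)|}
      ≤ ENNReal.ofReal (Real.exp (-(c * t)) * Real.exp (2 + 15 * d + 20 * c ^ 2 * (m * V))) := by
  classical
  set E := Real.exp (B / β) with hE
  set L := E ^ 4 / β with hL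
  have hm' : (0 : ℝ) < m := by exact_mod_cast hm
  -- outside of `F` the functions are irrelevant; they are set to zero to have a uniform bound
  set g : Table N K → Example N K → ℝ := fun r => if r ∈ F then weightedScore πref β r else 0
    with hg
  have hgF : ∀ r ∈ F, g r = weightedScore πref β r := fun r hr => if_pos hr
  have hset : {z : Fin m → Example N K | ∃ r ∈ F,
        t < |∑ i, (weightedScore πref β r (z i) - ∫ e, weightedScore πref β r e ∂P)|}
      = {z | ∃ r ∈ F, t < |∑ i, (g r (z i) - ∫ e, g r e ∂P)|} := by
    ext z
    refine exists_congr fun r => and_congr_right fun hr => ?_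
    rw [hgF r hr]
  rw [hset]
  refine measure_exists_abs_sum_sub_gt_le P m F g (W := E ^ 2) ?_ ?_ hc ?_
  · intro r
    by_cases hr : r ∈ F
    · rw [hgF r hr]; exact measurable_weightedScore _ _ _
    · simp only [hg, hr, if_false]; exact measurable_zero
  · intro r e
    by_cases hr : r ∈ F
    · rw [hgF r hr, abs_of_nonneg (weightedScore_mem πref hβ (hB r (hF r hr)) e).1]
      exact (weightedScore_mem πref hβ (hB r (hF r hr)) e).2
    · simp only [hg, hr, if_false, Pi.zero_apply, abs_zero]; positivity
  · intro z z'
    have hV0 : 0 ≤ V := by rw [hV]; positivity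
    have hch := chaining F (fun r (i : Fin m) => g r (z i) - g r (z' i)) (D := 5 * d)
      (V := m * V) hc (by positivity) (by positivity) ?_ ?_
    · rw [Fintype.card_fin] at hch
      refine hch.imp fun Ψ hΨ => ⟨hΨ.1, hΨ.2.trans (le_of_eq ?_)⟩
      congr 3; ring
    · intro r hr
      calc ∑ i, (g r (z i) - g r (z' i)) ^ 2 ≤ ∑ _i : Fin m, E ^ 4 := by
            refine Finset.sum_le_sum fun i _ => ?_
            have h1 := weightedScore_mem πref hβ (hB r (hF r hr)) (z i)
            have h2 := weightedScore_mem πref hβ (hB r (hF r hr)) (z' i)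
            rw [hgF r hr, show E ^ 4 = (E ^ 2) ^ 2 by ring]
            exact sq_le_sq' (by linarith) (by linarith)
        _ = m * E ^ 4 := by simp
        _ ≤ m * V := by
            gcongr
            rw [hV]
            exact le_add_of_nonneg_right (by positivity)
    · intro k
      set μ : Fin N × Fin K → ℝ := fun q =>
        (∑ i, (cellWeight πref (z i) q + cellWeight πref (z' i) q)) / (2 * m) with hμ
      have hμsum : ∀ f : Fin N × Fin K → ℝ, ∑ q, μ q * f q
          = (∑ i, (∑ q, cellWeight πref (z i) q * f q + ∑ q, cellWeight πref (z' i) q * f q))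
            / (2 * m) := by
        intro f
        simp only [hμ, ← Finset.sum_add_distrib]
        rw [Finset.sum_comm, Finset.sum_div]
        refine Finset.sum_congr rfl fun q _ => ?_
        rw [div_mul_eq_mul_div, Finset.sum_mul]
        congr 1
        exact Finset.sum_congr rfl fun i _ => by ring
      have hμ0 : ∀ q, 0 ≤ μ q := fun q => div_nonneg (Finset.sum_nonneg fun i _ =>
        add_nonneg (cellWeight_nonneg _ _ _) (cellWeight_nonneg _ _ _)) (by positivity)
      have hμ1 : ∑ q, μ q = 1 := by
        have hone : ∀ e, ∑ q, cellWeight πref e q * 1 = 1 := fun e => by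
          rw [sum_cellWeight_mul πref e fun _ => 1]
          simp only [mul_one, sum_toReal_eq_one]
          norm_num
        have h := hμsum fun _ => 1
        simp only [hone] at h
        rw [← Finset.sum_congr rfl fun q _ => mul_one (μ q), h]
        simp only [Finset.sum_const, Finset.card_univ, Fintype.card_fin, nsmul_eq_mul]
        field_simp
        norm_num
      obtain ⟨T, hTF, hTc, hTn⟩ := exists_net hH hd hB μ hμ0 hμ1 F hF k
      refine ⟨T, hTF, hTc, fun r hr => ?_⟩
      obtain ⟨s, hs, hrs⟩ := hTn r hr
      refine ⟨s, hs, ?_⟩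
      have hBr := hB r (hF r hr)
      have hBs := hB s (hF s (hTF hs))
      have hdist : weightedDist μ r s = (∑ i, (weightedDist (cellWeight πref (z i)) r s
          + weightedDist (cellWeight πref (z' i)) r s)) / (2 * m) := hμsum _
      have hne : 0 ≤ B := by
        rcases Nat.eq_zero_or_pos N with rfl | hN
        · exact (z ⟨0, hm⟩).1.elim0
        · exact (abs_nonneg _).trans (hBr (z ⟨0, hm⟩).1 (z ⟨0, hm⟩).2.1)
      rw [hgF r hr, hgF s (hTF hs)]
      calc ∑ i, (weightedScore πref β r (z i) - weightedScore πref β r (z' i)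
            - (weightedScore πref β s (z i) - weightedScore πref β s (z' i))) ^ 2
          ≤ ∑ i, 16 * B * L ^ 2 * (weightedDist (cellWeight πref (z i)) r s
            + weightedDist (cellWeight πref (z' i)) r s) := by
            refine Finset.sum_le_sum fun i _ => ?_
            have h1 := sq_weightedScore_sub_le πref hβ hBr hBs (z i)
            have h2 := sq_weightedScore_sub_le πref hβ hBr hBs (z' i)
            rw [← hE, ← hL] at h1 h2
            nlinarith [sq_nonneg ((weightedScore πref β r (z i) - weightedScore πref β s (z i))
              + (weightedScore πref β r (z' i) - weightedScore πref β s (z' i)))]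
        _ = 16 * B * L ^ 2 * (2 * m) * weightedDist μ r s := by
            rw [hdist, ← Finset.mul_sum]
            field_simp
        _ ≤ 16 * B * L ^ 2 * (2 * m) * (2 * B * (1 / 4) ^ k) := by gcongr
        _ = m * (64 * B ^ 2 * L ^ 2) * (1 / 4) ^ k := by ring
        _ ≤ m * V * (1 / 4) ^ k := by
            gcongr
            rw [hV]
            exact le_add_of_nonneg_left (by positivity)

theorem measurable_entry {N K : ℕ} (x : Fin N) (y : Fin K) :
    Measurable fun s : Table N K => s x y := by
  have h : Measurable fun s : Table N K => s x := measurable_pi_apply x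
  exact (measurable_pi_apply y).comp h

theorem measurable_exampleMap (N K : ℕ) :
    Measurable fun p : (Fin N × Fin K) × Table N K =>
      ((p.1.1, p.1.2, p.2 p.1.1 p.1.2) : Example N K) :=
  measurable_from_prod_countable_right fun c =>
    (measurable_const (a := c.1)).prodMk ((measurable_const (a := c.2)).prodMk
      (measurable_entry c.1 c.2))

instance isProbabilityMeasure_exampleLaw {N K : ℕ} (D : PMF (Fin N)) (πref : Fin N → PMF (Fin K))
    (Q : Measure (Table N K)) [IsProbabilityMeasure Q] :
    IsProbabilityMeasure (exampleLaw D πref Q) :=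
  Measure.isProbabilityMeasure_map (measurable_exampleMap N K).aemeasurable

theorem IsNoisyJudge.integral_clip {N K : ℕ} {U : Table N K} {δ η : ℝ} {Q : Measure (Table N K)}
    (hQ : IsNoisyJudge U δ η Q) (x : Fin N) (y : Fin K) :
    ∫ s, max 0 (min (s x y) 1) ∂Q = U x y := by
  have := hQ.isProbabilityMeasure
  have h1 : (fun s : Table N K => max 0 (min (s x y) 1)) =ᵐ[Q] fun s => s x y := by
    filter_upwards [hQ.score_mem] with s hs
    rw [min_eq_left (hs x y).2, max_eq_right (hs x y).1]
  have hi : Integrable (fun s : Table N K => s x y) Q :=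
    Integrable.of_bound (measurable_entry x y).aestronglyMeasurable 1 (by
      filter_upwards [hQ.score_mem] with s hs
      rw [Real.norm_of_nonneg (hs x y).1]
      exact (hs x y).2)
  have h2 := hQ.unbiased x y
  rw [integral_sub hi (integrable_const _)] at h2
  simp only [integral_const, probReal_univ, one_smul] at h2
  rw [integral_congr_ae h1]
  linarith

theorem bind_map_apply {N K : ℕ} (D : PMF (Fin N)) (πref : Fin N → PMF (Fin K)) (x : Fin N)
    (y : Fin K) : (D.bind fun x => (πref x).map (Prod.mk x)) (x, y) = D x * πref x y := by
  rw [PMF.bind_apply, tsum_fintype, Finset.sum_eq_single x]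
  · rw [PMF.map_apply, tsum_fintype, Finset.sum_eq_single y]
    · simp
    · intro z _ hz; simp [hz.symm]
    · simp
  · intro z _ hz
    rw [PMF.map_apply]
    simp [hz.symm]
  · simp

/-- The importance weighted scores are unbiased estimates of the expected utility. -/
theorem integral_weightedScore {N K : ℕ} (πref : Fin N → PMF (Fin K)) {β B : ℝ} (hβ : 0 < β)
    {r : Table N K} (hr : ∀ x y, |r x y| ≤ B) (D : PMF (Fin N)) {U : Table N K} {δ η : ℝ}
    {Q : Measure (Table N K)} (hQ : IsNoisyJudge U δ η Q) :
    ∫ e, weightedScore πref β r e ∂exampleLaw D πref Q = expectedUtility D πref β U r := by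
  have := hQ.isProbabilityMeasure
  rw [exampleLaw, integral_map (measurable_exampleMap N K).aemeasurable
    (measurable_weightedScore πref β r).aestronglyMeasurable, integral_prod]
  · rw [PMF.integral_eq_sum, Fintype.sum_prod_type, expectedUtility]
    refine Finset.sum_congr rfl fun x _ => ?_
    rw [Finset.mul_sum]
    refine Finset.sum_congr rfl fun y _ => ?_
    simp only [weightedScore]
    rw [integral_const_mul, hQ.integral_clip, bind_map_apply, policy_eq, ENNReal.toReal_mul,
      smul_eq_mul]
    ring
  · refine Integrable.of_bound ((measurable_weightedScore πref β r).comp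
      (measurable_exampleMap N K)).aestronglyMeasurable (Real.exp (B / β) ^ 2)
      (Filter.Eventually.of_forall fun p => ?_)
    have := weightedScore_mem πref hβ hr (p.1.1, p.1.2, p.2 p.1.1 p.1.2)
    rw [Real.norm_of_nonneg this.1]
    exact this.2

/-- The expected utility is a Lipschitz function of the reward. -/
theorem abs_expectedUtility_sub_le {N K : ℕ} (πref : Fin N → PMF (Fin K)) {β B ρ : ℝ}
    (hβ : 0 < β) {r s : Table N K} (hr : ∀ x y, |r x y| ≤ B) (hs : ∀ x y, |s x y| ≤ B)
    (hrs : ∀ x y, |r x y - s x y| ≤ ρ) (D : PMF (Fin N)) {U : Table N K}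
    (hU : ∀ x y, U x y ∈ Set.Icc (0 : ℝ) 1) :
    |expectedUtility D πref β U r - expectedUtility D πref β U s|
      ≤ 2 * (Real.exp (B / β) ^ 4 / β) * ρ := by
  set L := Real.exp (B / β) ^ 4 / β with hL
  have hL0 : 0 ≤ L := by positivity
  have h1 : ∀ x y, |policyRatio πref β r x y - policyRatio πref β s x y| ≤ 2 * L * ρ := by
    intro x y
    have h2 : ∑ z, (πref x z).toReal * |r x z - s x z| ≤ ρ := by
      calc _ ≤ ∑ z, (πref x z).toReal * ρ := Finset.sum_le_sum fun z _ =>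
            mul_le_mul_of_nonneg_left (hrs _ _) ENNReal.toReal_nonneg
        _ = ρ := by rw [← Finset.sum_mul, sum_toReal_eq_one, one_mul]
    refine (abs_policyRatio_sub_le πref hβ hr hs x y).trans ?_
    rw [← hL, mul_comm 2 L, mul_assoc]
    gcongr
    linarith [hrs x y]
  rw [expectedUtility, expectedUtility, ← Finset.sum_sub_distrib]
  calc |∑ x, ((D x).toReal * ∑ y, policy πref β r x y * U x y
        - (D x).toReal * ∑ y, policy πref β s x y * U x y)|
      ≤ ∑ x, (D x).toReal * (2 * L * ρ) := by
        refine (Finset.abs_sum_le_sum_abs _ _).trans (Finset.sum_le_sum fun x _ => ?_)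
        rw [← mul_sub, abs_mul, abs_of_nonneg ENNReal.toReal_nonneg, ← Finset.sum_sub_distrib]
        refine mul_le_mul_of_nonneg_left ?_ ENNReal.toReal_nonneg
        calc |∑ y, (policy πref β r x y * U x y - policy πref β s x y * U x y)|
            ≤ ∑ y, (πref x y).toReal * (2 * L * ρ) := by
              refine (Finset.abs_sum_le_sum_abs _ _).trans (Finset.sum_le_sum fun y _ => ?_)
              rw [policy_eq, policy_eq, ← sub_mul, ← mul_sub, abs_mul, abs_mul,
                abs_of_nonneg ENNReal.toReal_nonneg, abs_of_nonneg (hU x y).1, mul_assoc]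
              refine mul_le_mul_of_nonneg_left ?_ ENNReal.toReal_nonneg
              exact (mul_le_of_le_one_right (abs_nonneg _) (hU x y).2).trans (h1 x y)
          _ = _ := by rw [← Finset.sum_mul, sum_toReal_eq_one, one_mul]
    _ = _ := by rw [← Finset.sum_mul, sum_toReal_eq_one, one_mul]

theorem policy_nonneg_and_sum {N K : ℕ} (πref : Fin N → PMF (Fin K)) {β B : ℝ} (hβ : 0 < β)
    {r : Table N K} (hr : ∀ x y, |r x y| ≤ B) (x : Fin N) :
    (∀ y, 0 ≤ policy πref β r x y) ∧ ∑ y, policy πref β r x y = 1 := by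
  refine ⟨fun y => ?_, ?_⟩
  · rw [policy_eq]
    exact mul_nonneg ENNReal.toReal_nonneg (policyRatio_mem πref hβ hr x y).1
  · have hZ := partitionFunction_mem πref hβ hr x
    have hZ0 : 0 < partitionFunction πref β r x := (inv_pos.2 (Real.exp_pos _)).trans_le hZ.1
    simp only [policy]
    rw [← Finset.sum_div]
    exact div_self hZ0.ne'

theorem expectedUtility_mem {N K : ℕ} (πref : Fin N → PMF (Fin K)) {β B : ℝ} (hβ : 0 < β)
    {r : Table N K} (hr : ∀ x y, |r x y| ≤ B) (D : PMF (Fin N)) {U : Table N K}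
    (hU : ∀ x y, U x y ∈ Set.Icc (0 : ℝ) 1) :
    0 ≤ expectedUtility D πref β U r ∧ expectedUtility D πref β U r ≤ 1 := by
  have h := fun x => policy_nonneg_and_sum πref hβ hr x
  constructor
  · exact Finset.sum_nonneg fun x _ => mul_nonneg ENNReal.toReal_nonneg
      (Finset.sum_nonneg fun y _ => mul_nonneg ((h x).1 y) (hU x y).1)
  · calc expectedUtility D πref β U r ≤ ∑ x, (D x).toReal * 1 := by
          refine Finset.sum_le_sum fun x _ => mul_le_mul_of_nonneg_left ?_ ENNReal.toReal_nonneg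
          rw [← (h x).2]
          exact Finset.sum_le_sum fun y _ => mul_le_of_le_one_right ((h x).1 y) (hU x y).2
      _ = 1 := by simp [sum_toReal_eq_one]

/-- A measurable choice of a maximizer over a finite set. -/
theorem exists_measurable_argmax {Ω R : Type*} [MeasurableSpace Ω] [MeasurableSpace R]
    {F : Finset R} (hF : F.Nonempty) (f : R → Ω → ℝ) (hf : ∀ r, Measurable (f r)) :
    ∃ A : Ω → R, Measurable A ∧ (Measurable fun ω => f (A ω) ω) ∧ (∀ ω, A ω ∈ F) ∧
      ∀ ω, ∀ r ∈ F, f r ω ≤ f (A ω) ω := by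
  classical
  induction hF using Finset.Nonempty.cons_induction with
  | singleton r =>
    exact ⟨fun _ => r, measurable_const, hf r, by simp, by simp⟩
  | cons r F hr hF ih =>
    obtain ⟨A, hA, hfA, hAF, hmax⟩ := ih
    have hset : MeasurableSet {ω | f (A ω) ω ≤ f r ω} := measurableSet_le hfA (hf r)
    refine ⟨fun ω => if f (A ω) ω ≤ f r ω then r else A ω,
      Measurable.ite hset measurable_const hA, ?_, fun ω => ?_, fun ω s hs => ?_⟩
    · have : (fun ω => f (if f (A ω) ω ≤ f r ω then r else A ω) ω)
          = fun ω => if f (A ω) ω ≤ f r ω then f r ω else f (A ω) ω := by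
        ext ω; split_ifs <;> rfl
      rw [this]
      exact Measurable.ite hset (hf r) hfA
    · dsimp only
      split_ifs <;> simp [hAF]
    · dsimp only
      rw [Finset.mem_cons] at hs
      split_ifs with h <;> rcases hs with rfl | hs
      · exact le_rfl
      · exact (hmax ω s hs).trans h
      · exact (not_le.1 h).le
      · exact hmax ω s hs

/-- A bounded class of tables is approximated uniformly by a finite subclass. -/
theorem exists_finite_approx {N K : ℕ} {H : Set (Table N K)} {B : ℝ}
    (hB : ∀ r ∈ H, ∀ x y, |r x y| ≤ B) {ρ : ℝ} (hρ : 0 < ρ) :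
    ∃ F : Finset (Table N K), (∀ r ∈ F, r ∈ H) ∧
      ∀ r ∈ H, ∃ s ∈ F, ∀ x y, |r x y - s x y| ≤ ρ := by
  have hbdd : TotallyBounded H := by
    refine (isCompact_closedBall (0 : Table N K) (max B 0)).totallyBounded.subset fun r hr => ?_
    rw [mem_closedBall_zero_iff, pi_norm_le_iff_of_nonneg (le_max_right _ _)]
    intro x
    rw [pi_norm_le_iff_of_nonneg (le_max_right _ _)]
    exact fun y => (hB r hr x y).trans (le_max_left _ _)
  obtain ⟨t, htH, htf, ht⟩ := Metric.finite_approx_of_totallyBounded hbdd ρ hρ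
  refine ⟨htf.toFinset, fun r hr => htH (htf.mem_toFinset.1 hr), fun r hr => ?_⟩
  obtain ⟨s, hs, hrs⟩ := Set.mem_iUnion₂.1 (ht hr)
  refine ⟨s, htf.mem_toFinset.2 hs, fun x y => ?_⟩
  rw [Metric.mem_ball] at hrs
  exact (dist_le_pi_dist (r x) (s x) y).trans ((dist_le_pi_dist r s x).trans hrs.le)

theorem subsingleton_of_rewardVCDim_le_zero {N K : ℕ} {H : Set (Table N K)}
    (hH : rewardVCDim H ≤ (0 : ℕ)) {r s : Table N K} (hr : r ∈ H) (hs : s ∈ H) : r = s := by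
  classical
  by_contra hne
  obtain ⟨x, y, hxy⟩ : ∃ x y, r x y ≠ s x y := by
    by_contra! h
    exact hne (funext fun x => funext fun y => h x y)
  wlog h : r x y < s x y generalizing r s
  · exact this hs hr (Ne.symm hne) hxy.symm (lt_of_le_of_ne (not_lt.1 h) hxy.symm)
  have hsh : Shatters (subgraph '' H) {(((x, y), r x y) : (Fin N × Fin K) × ℝ)} := by
    intro T hT
    rcases Finset.subset_singleton_iff.1 hT with rfl | rfl
    · refine ⟨subgraph r, ⟨r, hr, rfl⟩, fun p hp => ?_⟩
      rw [Finset.mem_singleton] at hp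
      simp [hp, subgraph]
    · refine ⟨subgraph s, ⟨s, hs, rfl⟩, fun p hp => ?_⟩
      rw [Finset.mem_singleton] at hp
      simp [hp, subgraph, h]
  have := card_le_of_rewardVCDim_le hH hsh
  simp at this

theorem isSuccessfulLearner_const {N K m : ℕ} {πref : Fin N → PMF (Fin K)} {β ε δ η : ℝ}
    {H : Set (Table N K)} (hη : 0 ≤ η) {r₀ : Table N K} (hr₀ : r₀ ∈ H)
    (h : ∀ (D : PMF (Fin N)) (U : Table N K), (∀ x y, U x y ∈ Set.Icc (0 : ℝ) 1) → ∀ r ∈ H,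
      expectedUtility D πref β U r - ε ≤ expectedUtility D πref β U r₀) :
    IsSuccessfulLearner πref β H ε δ η m fun _ => r₀ where
  measurable := measurable_const
  output_mem _ := hr₀
  success D U Q hU hQ := by
    have := hQ.isProbabilityMeasure
    have : IsProbabilityMeasure (sampleLaw m D πref Q) := by
      unfold sampleLaw; infer_instance
    have hset : {S : Fin m → Example N K | ∀ r ∈ H,
        expectedUtility D πref β U r - ε ≤ expectedUtility D πref β U r₀} = Set.univ :=
      Set.eq_univ_of_forall fun _ => h D U hU
    rw [hset, measure_univ]
    exact ENNReal.ofReal_le_one.2 (by linarith)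

/-- Empirical maximization of the importance weighted score over a finite net is successful. -/
theorem exists_isSuccessfulLearner {N K d m : ℕ} (πref : Fin N → PMF (Fin K)) {β B ε δ η V : ℝ}
    (hβ : 0 < β) {H : Set (Table N K)} (hne : H.Nonempty) (hH : rewardVCDim H ≤ d) (hd : 1 ≤ d)
    (hB : ∀ r ∈ H, ∀ x y, |r x y| ≤ B) (hε : 0 < ε) (hη : 0 < η) (hη2 : η ≤ 1 / 2)
    (hV : V = Real.exp (B / β) ^ 4 + 64 * B ^ 2 * (Real.exp (B / β) ^ 4 / β) ^ 2) (hm : 0 < m)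
    (hmV : 44800 * V * (d * Real.log (1 / η)) ≤ m * ε ^ 2) :
    ∃ A : (Fin m → Example N K) → Table N K, IsSuccessfulLearner πref β H ε δ η m A := by
  have hV0 : 0 < V := by rw [hV]; positivity
  set L := Real.exp (B / β) ^ 4 / β with hL
  have hL0 : 0 < L := by positivity
  have hm' : (0 : ℝ) < m := by exact_mod_cast hm
  obtain ⟨F, hF, hFapp⟩ := exists_finite_approx hB (ρ := ε / (4 * L)) (by positivity)
  have hFne : F.Nonempty := by
    obtain ⟨r, hr⟩ := hne
    obtain ⟨s, hs, -⟩ := hFapp r hr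
    exact ⟨s, hs⟩
  obtain ⟨A, hA, -, hAF, hmax⟩ := exists_measurable_argmax hFne
    (fun r (S : Fin m → Example N K) => ∑ i, weightedScore πref β r (S i))
    fun r => Finset.measurable_sum _ fun i _ =>
      (measurable_weightedScore πref β r).comp (measurable_pi_apply i)
  refine ⟨A, hA, fun S => hF _ (hAF S), fun D U Q hU hQ => ?_⟩
  have := hQ.isProbabilityMeasure
  set c := ε / (160 * V) with hc
  have hc0 : 0 ≤ c := by positivity
  set bad : Set (Fin m → Example N K) := {z | ∃ r ∈ F, m * (ε / 4) <
    |∑ i, (weightedScore πref β r (z i)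
      - ∫ e, weightedScore πref β r e ∂exampleLaw D πref Q)|} with hbad
  have hdev : sampleLaw m D πref Q bad ≤ ENNReal.ofReal η := by
    refine (measure_exists_weightedScore_gt_le πref hβ hH hd hB F hF hm (exampleLaw D πref Q)
      hc0 hV).trans (ENNReal.ofReal_le_ofReal ?_)
    rw [← Real.exp_add, ← Real.le_log_iff_exp_le hη]
    have hlog : Real.log (1 / η) = -Real.log η := by rw [one_div, Real.log_inv]
    have hl2 : 1 / 2 ≤ Real.log (1 / η) := by
      have h1 : Real.log 2 ≤ Real.log (1 / η) :=
        Real.log_le_log (by norm_num) (by rw [le_div_iff₀ hη]; linarith)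
      linarith [Real.log_two_gt_d9]
    have hd' : (1 : ℝ) ≤ d := by exact_mod_cast hd
    have h1 : -(c * (m * (ε / 4))) + (2 + 15 * d + 20 * c ^ 2 * (m * V))
        = 2 + 15 * d - m * ε ^ 2 / (1280 * V) := by
      rw [hc]
      field_simp
      ring
    have h2 : 35 * (d * Real.log (1 / η)) ≤ m * ε ^ 2 / (1280 * V) := by
      rw [le_div_iff₀ (by positivity)]
      linarith
    have h3 : (d : ℝ) * (1 / 2) ≤ d * Real.log (1 / η) := by gcongr
    have h4 : Real.log (1 / η) ≤ d * Real.log (1 / η) := by nlinarith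
    rw [h1]
    linarith
  have hgood : badᶜ ⊆ {S | ∀ r ∈ H, expectedUtility D πref β U r - ε
      ≤ expectedUtility D πref β U (A S)} := by
    intro S hS r hr
    have hS' : ∀ r ∈ F, |∑ i, weightedScore πref β r (S i) - m * expectedUtility D πref β U r|
        ≤ m * (ε / 4) := by
      intro r hr
      by_contra hcon
      refine hS ⟨r, hr, ?_⟩
      rw [integral_weightedScore πref hβ (hB r (hF r hr)) D hQ, Finset.sum_sub_distrib]
      simpa using hcon
    obtain ⟨s, hs, hrs⟩ := hFapp r hr
    have h1 := abs_expectedUtility_sub_le πref hβ (hB r hr) (hB s (hF s hs)) hrs D hU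
    have h2 : 2 * L * (ε / (4 * L)) = ε / 2 := by field_simp; norm_num
    rw [← hL, h2] at h1
    have h3 := (abs_le.1 (hS' s hs)).1
    have h4 := (abs_le.1 (hS' (A S) (hAF S))).2
    have h5 := hmax S s hs
    have h6 := (abs_le.1 h1).2
    have h7 : (m : ℝ) * (expectedUtility D πref β U s - ε / 2)
        ≤ m * expectedUtility D πref β U (A S) := by linarith
    have h8 := le_of_mul_le_mul_left h7 hm'
    linarith
  have hP : IsProbabilityMeasure (sampleLaw m D πref Q) := by
    unfold sampleLaw; infer_instance
  calc ENNReal.ofReal (1 - η) = 1 - ENNReal.ofReal η := by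
        rw [ENNReal.ofReal_sub _ hη.le, ENNReal.ofReal_one]
    _ ≤ 1 - sampleLaw m D πref Q bad := tsub_le_tsub_left hdev 1
    _ ≤ sampleLaw m D πref Q badᶜ := by
        rw [tsub_le_iff_right, ← measure_univ (μ := sampleLaw m D πref Q),
          ← Set.compl_union_self bad]
        exact measure_union_le _ _
    _ ≤ _ := measure_mono hgood

end UtilityLearning

theorem mainTheorem6 (β B : ℝ) (hβ : 0 < β) :
    ∃ C : ℝ, 0 < C ∧
      ∀ (N K d : ℕ) (ε δ η : ℝ), 0 < ε → 0 ≤ δ → 0 < η → η ≤ 1 / 2 →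
        ∃ m : ℕ,
          (m : ℝ) ≤ C * ((N * K * Real.log K + d / ε ^ 2 + N * δ ^ 2 / ε ^ 2) * Real.log (1 / η)) ∧
          ∀ (πref : Fin N → PMF (Fin K)) (H : Set (UtilityLearning.Table N K)),
            H.Nonempty → (∀ r ∈ H, ∀ x y, |r x y| ≤ B) → UtilityLearning.rewardVCDim H ≤ d →
            ∃ A : (Fin m → UtilityLearning.Example N K) → UtilityLearning.Table N K,
              UtilityLearning.IsSuccessfulLearner πref β H ε δ η m A := by
  set V : ℝ := Real.exp (B / β) ^ 4 + 64 * B ^ 2 * (Real.exp (B / β) ^ 4 / β) ^ 2 with hV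
  have hV0 : 0 < V := by positivity
  refine ⟨44800 * V + 2, by positivity, fun N K d ε δ η hε hδ hη hη2 => ?_⟩
  have hl2 : 1 / 2 ≤ Real.log (1 / η) := by
    have h1 : Real.log 2 ≤ Real.log (1 / η) :=
      Real.log_le_log (by norm_num) (by rw [le_div_iff₀ hη]; linarith)
    linarith [Real.log_two_gt_d9]
  have hNK : 0 ≤ N * K * Real.log K := by
    rcases Nat.eq_zero_or_pos K with rfl | hK
    · simp
    · have := Real.log_nonneg (by exact_mod_cast hK : (1 : ℝ) ≤ K)
      positivity
  by_cases htriv : 1 ≤ ε ∨ d = 0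
  · refine ⟨0, by push_cast; positivity, fun πref H hne hB hH => ?_⟩
    obtain ⟨r₀, hr₀⟩ := hne
    refine ⟨_, UtilityLearning.isSuccessfulLearner_const hη.le hr₀ fun D U hU r hr => ?_⟩
    rcases htriv with h | rfl
    · have h1 := UtilityLearning.expectedUtility_mem πref hβ (hB r hr) D hU
      have h2 := UtilityLearning.expectedUtility_mem πref hβ (hB r₀ hr₀) D hU
      linarith
    · rw [UtilityLearning.subsingleton_of_rewardVCDim_le_zero hH hr hr₀]
      linarith
  · push Not at htriv
    obtain ⟨hε1, hd0⟩ := htriv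
    have hd : 1 ≤ d := Nat.one_le_iff_ne_zero.2 hd0
    have hd' : (1 : ℝ) ≤ d := by exact_mod_cast hd
    set q := d / ε ^ 2 * Real.log (1 / η) with hq
    have hε2 : ε ^ 2 ≤ 1 := pow_le_one₀ hε.le hε1.le
    have hdε : 1 ≤ d / ε ^ 2 := by rw [le_div_iff₀ (by positivity)]; linarith
    have hq1 : 1 / 2 ≤ q := by nlinarith
    refine ⟨⌈44800 * V * q⌉₊, ?_, fun πref H hne hB hH => ?_⟩
    · have h1 := (Nat.ceil_lt_add_one (a := 44800 * V * q) (by positivity)).le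
      have h2 : 0 ≤ N * δ ^ 2 / ε ^ 2 := by positivity
      calc (⌈44800 * V * q⌉₊ : ℝ) ≤ (44800 * V + 2) * q := by linarith
        _ ≤ _ := by
          rw [hq]
          gcongr
          linarith
    · refine UtilityLearning.exists_isSuccessfulLearner πref hβ hne hH hd hB hε hη hη2 hV
        (Nat.ceil_pos.2 (by positivity)) ?_
      have h1 := Nat.le_ceil (44800 * V * q)
      calc 44800 * V * (d * Real.log (1 / η)) = 44800 * V * q * ε ^ 2 := by
            rw [hq]; field_simp
        _ ≤ _ := by gcongr
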